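/- Let $b>0$ and let $R_1,R_2,R_3$ be the reflections of the hyperbolic plane in three geodesics at pairwise distance $b$ that are permuted by a rotation of order $3$. Let $\Gamma_b=\langle R_1,R_2,R_3\rangle$, let $\Gamma_b^+$ be its orientation preserving subgroup, and let $X_b=\mathbb H^2/\Gamma_b^+$; this is the symmetric three-funnelled surface whose three simple closed geodesics around the funnels have length $2b$. Primitive (oriented) closed geodesics $\gamma$ of $X_b$ correspond to the conjugacy classes in $\Gamma_b^+$ of nontrivial elements that are not proper powers. Let $\ell(\gamma)$ be the length of $\gamma$, and let $\omega(\gamma)$ be its word length, the least number of reflections $R_1,R_2,R_3$ whose product represents the class. For $s\in\mathbb C$ put $$Z_{X_b}(s,z)=\prod_{n=0}^\infty\prod_{\gamma\ \mathrm{primitive}}\bigl(1-z^{\omega(\gamma)}e^{-(s+n)\ell(\gamma)}\bigr)=1+\sum_{n\ge1}a_n(s)z^n,\qquad a_0(s)=1,$$ where the $a_n(s)$ are the Taylor coefficients in $z$ at $z=0$, and let $Z_{12}(s)=1+\sum_{n=1}^{12}a_n(s)$. Let $$B(z)=\begin{pmatrix}0&0&1&z&0&0\\0&0&0&0&1&z\\1&z&0&0&0&0\\0&0&0&0&z&1\\z&1&0&0&0&0\\0&0&z&1&0&0\end{pmatrix}^{2}$$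 and $$\begin{aligned}&P_0=1,\quad P_1=-6,\quad P_2(y)=15-6y^2,\quad P_3(y)=-20+24y^2-6y^4-2y^6,\\ &P_4(y)=15-36y^2+27y^4-6y^6,\quad P_5(y)=-6(y^2-1)^4,\quad P_6(y)=(y^2-1)^6.\end{aligned}$$ (1) For all $x,y\in\mathbb C$ we have $\det(I-xB(y))=\sum_{k=0}^6x^kP_k(y)$. (2) There are constants $C$ and $b_0>0$ such that for all $b\ge b_0$, all $0\le\sigma\le\ln 2$ and all $t\in\mathbb R$, with $$s=\frac{\sigma}{b}+ite^{b},\qquad x=e^{-2\sigma-2itbe^b},\qquad y=e^{-it},$$ the product $Z_{X_b}(s,z)$ converges for all $z$ near $0$ and is analytic in $z$ at $z=0$, $$\bigl|a_{2k}(s)-x^kP_k(y)\bigr|\le C(1+|t|)e^{-b}\quad(0\le k\le 6),$$ and $$\Bigl|Z_{12}\Bigl(\frac{\sigma}{b}+ite^b\Bigr)-\det\bigl(I-e^{-2\sigma-2itbe^b}B(e^{-it})\bigr)\Bigr|\le C(1+|t|)e^{-b}.$$ (3) In particular, for every $S>0$, as $b\to\infty$, $$\Bigl|Z_{12}\Bigl(\frac{\sigma}{b}+ite^b\Bigr)-\det\bigl(I-e^{-2\sigma-2itbe^b}B(e^{-it})\bigr)\Bigr|=O(e^{-b})$$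 uniformly on the compact part $0\le\sigma\le\ln2$, $|t|\le S$ of the normalized critical strip (the constants depend only on $S$). -/

import Mathlib

open Polynomial UpperHalfPlane Matrix Filter Topology

noncomputable section

namespace ThreeFunnel

/-- The half-width (seen from the centre of the disc) of three geodesics of the unit disc with end
points `exp (i (2πj/3 ± θ))`, `j = 1, 2, 3`, whose pairwise hyperbolic distance is `b`. -/
def theta (b : ℝ) : ℝ := Real.arcsin (√3 / (2 * Real.cosh (b / 2)))

lemma sin_theta_ne_zero (b : ℝ) : Real.sin (theta b) ≠ 0 := by
  have hc : 1 ≤ Real.cosh (b / 2) := Real.one_le_cosh _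
  have h3 : √3 < 2 := by
    rw [Real.sqrt_lt' (by norm_num)]; norm_num
  have hp : 0 < √3 / (2 * Real.cosh (b / 2)) := by positivity
  have hl : √3 / (2 * Real.cosh (b / 2)) ≤ 1 := by
    rw [div_le_one (by positivity)]; linarith
  rw [theta, Real.sin_arcsin (by linarith) hl]
  exact hp.ne'

/-- The matrix of the reflection in the geodesic of the upper half-plane with end points
`tan ((φ - θ) / 2)` and `tan ((φ + θ) / 2)`; this is the image of the geodesic of the unit disc with
end points `exp (i (φ ± θ))` under `z ↦ i (1 - z) / (1 + z)`. It has determinant `-1`, hence acts on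
the upper half-plane by an orientation reversing isometry. -/
def reflMatrix (φ θ : ℝ) : Matrix (Fin 2) (Fin 2) ℝ :=
  !![Real.sin φ / Real.sin θ, (Real.cos φ - Real.cos θ) / Real.sin θ;
     (Real.cos φ + Real.cos θ) / Real.sin θ, -(Real.sin φ / Real.sin θ)]

lemma reflMatrix_mul_self (φ θ : ℝ) (h : Real.sin θ ≠ 0) :
    reflMatrix φ θ * reflMatrix φ θ = 1 := by
  have h1 := Real.sin_sq_add_cos_sq φ
  have h2 := Real.sin_sq_add_cos_sq θ
  ext i j
  fin_cases i <;> fin_cases j <;> simp [reflMatrix, Matrix.mul_apply] <;> field_simp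
  · nlinarith
  · ring
  · ring
  · nlinarith

/-- The reflections `R₁, R₂, R₃` in the three geodesics at pairwise distance `b`, as elements of
`GL(2, ℝ)` (acting on the upper half-plane; the matrices are involutions). -/
def refl (b : ℝ) (j : Fin 3) : GL (Fin 2) ℝ where
  val := reflMatrix (2 * Real.pi * ((j : ℝ) + 1) / 3) (theta b)
  inv := reflMatrix (2 * Real.pi * ((j : ℝ) + 1) / 3) (theta b)
  val_inv := reflMatrix_mul_self _ _ (sin_theta_ne_zero b)
  inv_val := reflMatrix_mul_self _ _ (sin_theta_ne_zero b)

/-- The group generated by the three reflections. -/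
def reflGroup (b : ℝ) : Subgroup (GL (Fin 2) ℝ) :=
  Subgroup.closure (Set.range (refl b))

/-- The orientation preserving subgroup, of index two: the fundamental group of the symmetric
three-funnelled surface `X_b`, which is the quotient of the upper half-plane by this group. The three
simple closed geodesics around the funnels come from the products `R_i R_j` and have length `2b`. -/
def surfaceGroup (b : ℝ) : Subgroup (GL (Fin 2) ℝ) :=
  reflGroup b ⊓ (Matrix.GeneralLinearGroup.det : GL (Fin 2) ℝ →* ℝˣ).ker

/-- The primitive (oriented) closed geodesics of `X_b`: the conjugacy classes of those nontrivial
elements of the fundamental group that are not proper powers. -/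
def PrimitiveGeodesic (b : ℝ) : Type :=
  {c : ConjClasses (surfaceGroup b) //
    ∃ g : surfaceGroup b, ConjClasses.mk g = c ∧ g ≠ 1 ∧
      ∀ (h : surfaceGroup b) (n : ℕ), 2 ≤ n → h ^ n ≠ g}

/-- The length of a closed geodesic: the least displacement of a point of the hyperbolic plane by an
element of the conjugacy class. -/
def geodesicLength {b : ℝ} (γ : PrimitiveGeodesic b) : ℝ :=
  sInf {d : ℝ | ∃ g : surfaceGroup b, ConjClasses.mk g = γ.1 ∧
    ∃ z : ℍ, d = dist z ((g : GL (Fin 2) ℝ) • z)}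

/-- The word length of a closed geodesic: the least number of reflections `R₁, R₂, R₃` whose product
represents the conjugacy class. -/
def wordLength {b : ℝ} (γ : PrimitiveGeodesic b) : ℕ :=
  sInf {n : ℕ | ∃ w : List (Fin 3), w.length = n ∧
    ∃ g : surfaceGroup b, ConjClasses.mk g = γ.1 ∧ (g : GL (Fin 2) ℝ) = (w.map (refl b)).prod}

/-- The factor of the Selberg zeta product that belongs to a pair `(n, γ)`, with the extra
variable `z` counting the word length. -/
def zetaFactor (b : ℝ) (s z : ℂ) (p : ℕ × PrimitiveGeodesic b) : ℂ :=
  1 - z ^ wordLength p.2 * Complex.exp (-((s + p.1) * geodesicLength p.2))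

/-- The two-variable Selberg zeta function `Z_{X_b}(s, z)` as an infinite product; for fixed `s` it
is used only for `z` near `0`. -/
def selbergZeta (b : ℝ) (s z : ℂ) : ℂ :=
  ∏' p : ℕ × PrimitiveGeodesic b, zetaFactor b s z p

/-- The coefficient `a_n(s)` of `z ^ n` in the Taylor expansion of `Z_{X_b}(s, z)` at `z = 0`. -/
def zetaCoeff (b : ℝ) (n : ℕ) (s : ℂ) : ℂ :=
  iteratedDeriv n (fun z : ℂ => selbergZeta b s z) 0 / (n.factorial : ℂ)

/-- The partial sum `Z_n(s) = 1 + a_1(s) + ⋯ + a_n(s)`. -/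
def partialZeta (b : ℝ) (n : ℕ) (s : ℂ) : ℂ :=
  1 + ∑ k ∈ Finset.Icc 1 n, zetaCoeff b k s

/-- The `6 × 6` matrix `B(z)`. -/
def matB (z : ℂ) : Matrix (Fin 6) (Fin 6) ℂ :=
  !![0, 0, 1, z, 0, 0;
     0, 0, 0, 0, 1, z;
     1, z, 0, 0, 0, 0;
     0, 0, 0, 0, z, 1;
     z, 1, 0, 0, 0, 0;
     0, 0, z, 1, 0, 0] ^ 2

/-- The polynomials `P_0, …, P_6` with integer coefficients. -/
def polyP : Fin 7 → ℤ[X] :=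
  ![1,
    -6,
    15 - 6 * X ^ 2,
    -20 + 24 * X ^ 2 - 6 * X ^ 4 - 2 * X ^ 6,
    15 - 36 * X ^ 2 + 27 * X ^ 4 - 6 * X ^ 6,
    -6 * (X ^ 2 - 1) ^ 4,
    (X ^ 2 - 1) ^ 6]

/-- The point `σ / b + i t e ^ b` with rescaled coordinates `σ, t`. -/
def sPoint (b σ t : ℝ) : ℂ :=
  (σ : ℂ) / b + Complex.I * t * Real.exp b

/-- `x = exp (-2σ - 2 i t b e ^ b)`. -/
def xVal (b σ t : ℝ) : ℂ :=
  Complex.exp (-2 * σ - 2 * Complex.I * t * b * Real.exp b)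

/-- `y = exp (-i t)`. -/
def yVal (t : ℝ) : ℂ := Complex.exp (-(Complex.I * t))

end ThreeFunnel

end

/-!
The zeta function is compared, factor by factor, with an Euler product for the determinant.

*Coding.* For `exp (-b) ≤ 1 / 100` the three reflections generate the free product of three groups
of order two (`wordProd_refl_ne_one`), so the conjugacy classes of the orientation preserving
subgroup are the cyclically reduced words of even length up to rotation by an even number of
letters (`exists_cycReduced`, `exists_rotate_of_conj`). Primitive closed geodesics are therefore the
orbits of the shift by two letters on the periodic sequences without equal consecutive letters
(`toGeodesic_eq_iff`, `toGeodesic_surjective`), and the word length is twice the period `p`.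

*Lengths.* A reflection maps, in suitable projective coordinates, the interval
`|u| ≤ tan ^ 2 (θ / 2)` attached to one letter into the interval attached to another one, and the
scaling factor of the vectors is explicit (`refl_mulVec`, `coneMap`, `log_growth`). The product of
reflections along a periodic sequence has a fixed direction in its interval, and the logarithm of
the eigenvalue is the sum of the contributions of the letters. As a result, the length of the
geodesic is `2 p b + T exp (-b) + O (p exp (-2 b))`, where `T` is the number of letters whose two
neighbours differ (`geodesicLength_toGeodesic`). At `s = σ / b + i t exp b` this turns `exp (-s ℓ)`
into `x ^ p y ^ T` up to `O (p (1 + |t|) exp (-b))`.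

*Euler product of the determinant.* `matB y` is the square of the transition matrix `matA y` on
ordered pairs of distinct letters, in which a step from `(i, j)` to `(j, k)` has weight `y` if
`k ≠ i` and weight `1` otherwise. Traces of its powers are thus sums of `y ^ T` over periodic
sequences, and grouping the series of `log det (1 - u B(y))` by orbits gives
`det (1 - u B(y)) = ∏ (1 - u ^ p y ^ T)` over the primitive closed geodesics
(`hasProd_one_sub_limitWeight`).

*Conclusion.* For `|z| ≤ 1 / 10` both products converge absolutely with a majorant independent of
`b`, so with `u = z ^ 2 x` they differ by `O ((1 + |t|) exp (-b))` (`norm_selbergZeta_sub_det_le`);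
the factors with `n ≥ 1` are negligible since no geodesic is shorter than `b`. Cauchy's estimate on
the circle `|z| = 1 / 20` carries this over to the Taylor coefficients at `z = 0`, and the
determinant is a polynomial of degree at most `12` in `z`.
-/

noncomputable section

namespace ThreeFunnel

/-! ### The determinant -/

/-- The `6 × 6` matrix whose square is `matB`. -/
def matA (z : ℂ) : Matrix (Fin 6) (Fin 6) ℂ :=
  !![0, 0, 1, z, 0, 0;
     0, 0, 0, 0, 1, z;
     1, z, 0, 0, 0, 0;
     0, 0, 0, 0, z, 1;
     z, 1, 0, 0, 0, 0;
     0, 0, z, 1, 0, 0]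

lemma matB_eq (z : ℂ) : matB z = matA z ^ 2 := rfl

lemma det_fromBlocks_symm {n R : Type*} [Fintype n] [DecidableEq n] [CommRing R]
    (P Q : Matrix n n R) : (fromBlocks P Q Q P).det = (P - Q).det * (P + Q).det := by
  have h : fromBlocks 1 0 1 1 * fromBlocks P Q Q P * fromBlocks 1 0 (-1) 1 =
      fromBlocks (P - Q) Q 0 (P + Q) := by
    simp [fromBlocks_multiply, sub_eq_add_neg, add_comm Q P]
  have h2 := congrArg Matrix.det h
  rwa [det_mul, det_mul, det_fromBlocks_zero₁₂, det_fromBlocks_zero₁₂, det_fromBlocks_zero₂₁,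
    det_one, one_mul, one_mul, mul_one] at h2

/-- The indices of `matA` stand for the ordered pairs of distinct elements of `Fin 3` in
lexicographic order. Here they are split into the pairs `(0, 1)`, `(1, 2)`, `(2, 0)` and the pairs
`(1, 0)`, `(0, 2)`, `(2, 1)`; this gives `matA` the block form of `det_fromBlocks_symm`. -/
def stateEquiv : Fin 3 ⊕ Fin 3 ≃ Fin 6 where
  toFun := Sum.elim ![0, 3, 4] ![2, 1, 5]
  invFun := ![.inl 0, .inr 1, .inr 0, .inl 1, .inl 2, .inr 2]
  left_inv := by decide
  right_inv := by decide

lemma matA_submatrix (y : ℂ) : (matA y).submatrix stateEquiv stateEquiv =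
    fromBlocks !![0, y, 0; 0, 0, y; y, 0, 0] !![1, 0, 0; 0, 0, 1; 0, 1, 0]
      !![1, 0, 0; 0, 0, 1; 0, 1, 0] !![0, y, 0; 0, 0, y; y, 0, 0] := by
  ext i j
  fin_cases i <;> fin_cases j <;> rfl

lemma det_one_sub_smul_matB (x y : ℂ) : (1 - x • matB y).det =
    ∑ k : Fin 7, x ^ (k : ℕ) * Polynomial.aeval y (polyP k) := by
  have h : (1 - x • matB y).submatrix stateEquiv stateEquiv =
      1 - x • ((matA y).submatrix stateEquiv stateEquiv *
        (matA y).submatrix stateEquiv stateEquiv) := by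
    rw [matB_eq, submatrix_mul_equiv, ← pow_two]
    ext i j
    simp [Matrix.one_apply]
  rw [← det_submatrix_equiv_self stateEquiv, h, matA_submatrix, fromBlocks_multiply,
    fromBlocks_smul, ← fromBlocks_one, sub_eq_add_neg, fromBlocks_neg, fromBlocks_add]
  simp only [zero_add, add_comm (!![1, 0, 0; 0, 0, 1; 0, 1, 0] * !![0, y, 0; 0, 0, y; y, 0, 0])
    (!![0, y, 0; 0, 0, y; y, 0, 0] * !![1, 0, 0; 0, 0, 1; 0, 1, 0] : Matrix (Fin 3) (Fin 3) ℂ),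
    add_comm (!![1, 0, 0; 0, 0, 1; 0, 1, 0] * !![1, 0, 0; 0, 0, 1; 0, 1, 0])
    (!![0, y, 0; 0, 0, y; y, 0, 0] * !![0, y, 0; 0, 0, y; y, 0, 0] : Matrix (Fin 3) (Fin 3) ℂ)]
  rw [det_fromBlocks_symm, det_fin_three, det_fin_three]
  simp [Fin.sum_univ_succ, polyP, map_ofNat (Polynomial.aeval (R := ℤ) y)]
  ring

/-! ### Determinants, traces of powers and closed paths -/

section Spectral

variable {n : Type*} [Fintype n] [DecidableEq n]

/-- Spectral mapping for determinants: both sides are multiplicative in `q`, and for linear `q`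
this is the factorization of the characteristic polynomial. -/
lemma det_aeval_eq_prod_roots_charpoly (M : Matrix n n ℂ) (q : ℂ[X]) :
    (Polynomial.aeval M q).det = (M.charpoly.roots.map q.eval).prod := by
  have hlin (μ : ℂ) : (M - algebraMap ℂ _ μ).det = (M.charpoly.roots.map fun l => l - μ).prod := by
    have h1 : M.charpoly.eval μ = (M.charpoly.roots.map fun l => μ - l).prod := by
      conv_lhs => rw [(IsAlgClosed.splits M.charpoly).eq_prod_roots_of_monic M.charpoly_monic]
      rw [eval_multiset_prod, Multiset.map_map]
      simp
    have h2 : M - algebraMap ℂ _ μ = -(Matrix.scalar n μ - M) := by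
      rw [neg_sub]; rfl
    have hc : Multiset.card M.charpoly.roots = Fintype.card n := by
      rw [← M.charpoly_natDegree_eq_dim]
      exact (IsAlgClosed.splits M.charpoly).natDegree_eq_card_roots.symm
    rw [h2, det_neg, ← eval_charpoly, h1, ← hc]
    have h3 : ∀ s : Multiset ℂ, (-1) ^ Multiset.card s * (s.map fun l => μ - l).prod =
        (s.map fun l => l - μ).prod := by
      intro s
      induction s using Multiset.induction with
      | empty => simp
      | cons a s ih =>
        simp only [Multiset.card_cons, Multiset.map_cons, Multiset.prod_cons, ← ih]
        ring
    exact h3 _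
  have hcard : Multiset.card M.charpoly.roots = Fintype.card n := by
    rw [← M.charpoly_natDegree_eq_dim]
    exact (IsAlgClosed.splits M.charpoly).natDegree_eq_card_roots.symm
  have hprod : ∀ s : Multiset ℂ, (Polynomial.aeval M (s.map fun a => X - C a).prod).det =
      (M.charpoly.roots.map (s.map fun a => X - C a).prod.eval).prod := by
    intro s
    induction s using Multiset.induction with
    | empty => simp
    | cons a s ih =>
      simp only [Multiset.map_cons, Multiset.prod_cons, map_mul, det_mul, ih, eval_mul,
        Multiset.prod_map_mul]
      simp [hlin]
  rw [(IsAlgClosed.splits q).eq_prod_roots, map_mul, det_mul, hprod]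
  simp only [eval_mul, Multiset.prod_map_mul, aeval_C, eval_C, Multiset.map_const',
    Multiset.prod_replicate, hcard, Matrix.algebraMap_eq_diagonal, det_diagonal]
  simp

lemma trace_pow_eq_sum_roots_charpoly (M : Matrix n n ℂ) (k : ℕ) :
    (M ^ k).trace = (M.charpoly.roots.map (· ^ k)).sum := by
  have h : (M ^ k).charpoly = ((M.charpoly.roots.map (· ^ k)).map fun a => X - C a).prod := by
    refine Polynomial.funext fun t => ?_
    rw [eval_charpoly, eval_multiset_prod, Multiset.map_map, Multiset.map_map]
    have := det_aeval_eq_prod_roots_charpoly M (C t - X ^ k)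
    simpa [Function.comp_def, Matrix.algebraMap_eq_diagonal, Pi.algebraMap_def] using this
  rw [trace_eq_sum_roots_charpoly, h, roots_multiset_prod_X_sub_C]

lemma det_one_sub_smul_eq_prod_roots_charpoly (M : Matrix n n ℂ) (u : ℂ) :
    (1 - u • M).det = (M.charpoly.roots.map fun l => 1 - u * l).prod := by
  have := det_aeval_eq_prod_roots_charpoly M (1 - C u * X)
  simpa [Algebra.smul_def] using this

/-- The spectral radius is at most the largest absolute row sum. -/
lemma norm_le_of_mem_roots_charpoly (M : Matrix n n ℂ) {K : ℝ} (hK : 0 ≤ K)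
    (hM : ∀ i, ∑ j, ‖M i j‖ ≤ K) {l : ℂ} (hl : l ∈ M.charpoly.roots) : ‖l‖ ≤ K := by
  have hroot : M.charpoly.eval l = 0 := (mem_roots'.1 hl).2
  rw [eval_charpoly] at hroot
  obtain ⟨v, hv0, hv⟩ := exists_mulVec_eq_zero_iff.2 hroot
  rw [sub_mulVec] at hv
  have hv' (i : n) : l * v i = ∑ j, M i j * v j := by
    have := congrFun hv i
    simp only [Pi.sub_apply, Pi.zero_apply, sub_eq_zero, Matrix.scalar_apply,
      mulVec_diagonal] at this
    rw [this]; rfl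
  have hpos : 0 < ‖v‖ := norm_pos_iff.2 hv0
  have hle : ‖l • v‖ ≤ K * ‖v‖ := by
    refine (pi_norm_le_iff_of_nonneg (by positivity)).2 fun i => ?_
    rw [Pi.smul_apply, smul_eq_mul, hv' i]
    calc ‖∑ j, M i j * v j‖ ≤ ∑ j, ‖M i j‖ * ‖v‖ := by
          refine norm_sum_le_of_le _ fun j _ => ?_
          rw [norm_mul]
          exact mul_le_mul_of_nonneg_left (norm_le_pi_norm v j) (norm_nonneg _)
      _ = (∑ j, ‖M i j‖) * ‖v‖ := by rw [Finset.sum_mul]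
      _ ≤ K * ‖v‖ := mul_le_mul_of_nonneg_right (hM i) hpos.le
  rw [norm_smul] at hle
  exact le_of_mul_le_mul_right hle hpos

/-- For small `u`, the logarithm of `det (1 - u M)` is `-∑ u ^ k tr (M ^ k) / k`; the term `k = 0`
vanishes since division by zero gives zero. -/
lemma det_one_sub_smul_eq_exp (M : Matrix n n ℂ) (u : ℂ)
    (hu : ∀ l ∈ M.charpoly.roots, ‖u * l‖ < 1) {S : ℂ}
    (hS : HasSum (fun k : ℕ => u ^ k * (M ^ k).trace / k) S) :
    (1 - u • M).det = Complex.exp (-S) := by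
  have key : ∀ s : Multiset ℂ, (∀ l ∈ s, ‖u * l‖ < 1) → ∃ L : ℂ,
      HasSum (fun k : ℕ => u ^ k * (s.map (· ^ k)).sum / k) L ∧
        (s.map fun l => 1 - u * l).prod = Complex.exp (-L) := by
    intro s
    induction s using Multiset.induction with
    | empty => exact fun _ => ⟨0, by simp, by simp⟩
    | cons a s ih =>
      intro hs
      obtain ⟨L, hL, hp⟩ := ih fun l hl => hs l (Multiset.mem_cons_of_mem hl)
      have ha := hs a (Multiset.mem_cons_self a s)
      refine ⟨-Complex.log (1 - u * a) + L, ?_, ?_⟩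
      · convert (Complex.hasSum_taylorSeries_neg_log ha).add hL using 1
        ext k
        rw [Multiset.map_cons, Multiset.sum_cons]
        ring
      · have hne : 1 - u * a ≠ 0 := by
          intro h0
          rw [← sub_eq_zero.1 h0] at ha
          simp at ha
        rw [Multiset.map_cons, Multiset.prod_cons, hp, neg_add, neg_neg, Complex.exp_add,
          Complex.exp_log hne]
  obtain ⟨L, hL, hp⟩ := key _ hu
  simp_rw [trace_pow_eq_sum_roots_charpoly] at hS
  rw [det_one_sub_smul_eq_prod_roots_charpoly, hp, hL.unique hS]

/-- Entries of powers are sums over paths with given end points. -/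
lemma pow_succ_apply_eq_sum {R : Type*} [CommRing R] (M : Matrix n n R) (k : ℕ) (i j : n) :
    (M ^ (k + 1)) i j = ∑ f : Fin k → n,
      ∏ l : Fin (k + 1),
        M (Fin.cons (α := fun _ => n) i f l) (Fin.snoc (α := fun _ => n) f j l) := by
  induction k generalizing i with
  | zero => simp; rfl
  | succ k ih =>
    rw [pow_succ', Matrix.mul_apply, ← (Fin.consEquiv fun _ => n).sum_comp, Fintype.sum_prod_type]
    refine Finset.sum_congr rfl fun a _ => ?_
    rw [ih, Finset.mul_sum]
    refine Finset.sum_congr rfl fun f _ => ?_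
    conv_rhs => rw [Fin.prod_univ_succ]
    simp [Fin.consEquiv, ← Fin.cons_snoc_eq_snoc_cons]

/-- The trace of a power is a sum over closed paths. -/
lemma trace_pow_eq_sum {R : Type*} [CommRing R] (M : Matrix n n R) (k : ℕ) [NeZero k] :
    (M ^ k).trace = ∑ f : Fin k → n, ∏ l : Fin k, M (f l) (f (l + 1)) := by
  obtain ⟨k, rfl⟩ := Nat.exists_eq_succ_of_ne_zero (NeZero.ne k)
  rw [← (Fin.consEquiv fun _ => n).sum_comp, Fintype.sum_prod_type, Matrix.trace]
  refine Finset.sum_congr rfl fun a _ => ?_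
  rw [diag_apply, pow_succ_apply_eq_sum]
  refine Finset.sum_congr rfl fun f _ => Finset.prod_congr rfl fun l _ => ?_
  congr 1
  induction l using Fin.lastCases with
  | last => simp [Fin.consEquiv]
  | cast l => simp [Fin.consEquiv]

end Spectral

/-! ### Words in a free product of groups of order two -/

section Words

variable {ι G : Type*} [Group G]

/-- The product of a word in the letters `r i`. -/
def wordProd (r : ι → G) (w : List ι) : G := (w.map r).prod

@[simp] lemma wordProd_nil (r : ι → G) : wordProd r [] = 1 := rfl

@[simp] lemma wordProd_cons (r : ι → G) (a : ι) (w : List ι) :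
    wordProd r (a :: w) = r a * wordProd r w := by simp [wordProd]

@[simp] lemma wordProd_append (r : ι → G) (v w : List ι) :
    wordProd r (v ++ w) = wordProd r v * wordProd r w := by simp [wordProd]

lemma inv_eq_self {r : ι → G} (hr : ∀ i, r i * r i = 1) (i : ι) : (r i)⁻¹ = r i :=
  inv_eq_of_mul_eq_one_left (hr i)

lemma involution_mul_cancel_left {r : ι → G} (hr : ∀ i, r i * r i = 1) (i : ι) (g : G) :
    r i * (r i * g) = g := by rw [← mul_assoc, hr, one_mul]

lemma wordProd_reverse {r : ι → G} (hr : ∀ i, r i * r i = 1) (w : List ι) :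
    wordProd r w.reverse = (wordProd r w)⁻¹ := by
  induction w with
  | nil => simp
  | cons a w ih => simp [ih, inv_eq_self hr]

/-- A word is reduced if no two consecutive letters agree. -/
abbrev Reduced (w : List ι) : Prop := w.IsChain (· ≠ ·)

/-- A word is cyclically reduced if no two cyclically consecutive letters agree; this is the same
as being reduced for the word written twice. -/
def CycReduced (w : List ι) : Prop := Reduced (w ++ w)

lemma CycReduced.reduced {w : List ι} (h : CycReduced w) : Reduced w :=
  List.IsChain.left_of_append h

lemma reduced_reverse {w : List ι} : Reduced w.reverse ↔ Reduced w := by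
  unfold Reduced
  rw [List.isChain_reverse]
  simp only [ne_comm]

lemma cycReduced_cons {a : ι} {w : List ι} :
    CycReduced (a :: w) ↔ Reduced (a :: (w ++ [a])) := by
  rw [CycReduced, Reduced, List.isChain_split, ← List.cons_append, and_iff_left_of_imp]
  exact fun h => List.IsChain.left_of_append h

lemma cycReduced_concat {a : ι} {w : List ι} :
    CycReduced (w ++ [a]) ↔ Reduced (a :: (w ++ [a])) := by
  rw [CycReduced, Reduced, List.append_assoc, List.singleton_append, List.isChain_split,
    and_iff_right_of_imp]
  exact fun h => h.tail

/-- If no nonempty reduced word has trivial product, then reduced words are determined by their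
products. -/
lemma wordProd_injOn_reduced {r : ι → G} (hr : ∀ i, r i * r i = 1)
    (hfree : ∀ w, w ≠ [] → Reduced w → wordProd r w ≠ 1) {u v : List ι} (hu : Reduced u)
    (hv : Reduced v) (h : wordProd r u = wordProd r v) : u = v := by
  induction u generalizing v with
  | nil =>
    by_contra hne
    exact hfree v (Ne.symm hne) hv h.symm
  | cons a u ih =>
    cases v with
    | nil => exact absurd h (hfree _ (List.cons_ne_nil _ _) hu)
    | cons b v =>
      by_cases hab : a = b
      · subst hab
        rw [ih hu.tail (v := v) hv.tail (by simpa using h)]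
      · exfalso
        refine hfree ((b :: v).reverse ++ a :: u) (by simp) ?_ ?_
        · rw [List.reverse_cons, List.append_assoc, List.singleton_append, Reduced,
            List.isChain_append_cons_cons]
          refine ⟨?_, Ne.symm hab, hu⟩
          rw [← List.reverse_cons]
          exact reduced_reverse.2 hv
        · rw [wordProd_append, wordProd_reverse hr, h, inv_mul_cancel]

/-- Cyclically reduced words with conjugate products are rotations of each other, and the parity of
the rotation is the parity of the conjugating word. The proof removes the last letter `a` of `u`: if
`w` begins or ends with `a`, this rotates `w` by one letter; otherwise the conjugate of `w` is
already reduced, but begins and ends with the same letter. -/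
lemma exists_rotate_of_conj {r : ι → G} (hr : ∀ i, r i * r i = 1)
    (hfree : ∀ w, w ≠ [] → Reduced w → wordProd r w ≠ 1) (u : List ι) (hu : Reduced u)
    {w w' : List ι} (hw : CycReduced w) (hw' : CycReduced w') (hne : w ≠ [])
    (heven : Even w.length) (h : wordProd r u * wordProd r w * (wordProd r u)⁻¹ = wordProd r w') :
    ∃ j, (Even j ↔ Even u.length) ∧ w' = w.rotate j := by
  induction u using List.reverseRecOn generalizing w with
  | nil =>
    refine ⟨0, by simp, ?_⟩
    rw [List.rotate_zero]
    exact wordProd_injOn_reduced hr hfree hw'.reduced hw.reduced (by simpa using h.symm)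
  | append_singleton u a ih =>
    have hu' : Reduced u := List.IsChain.left_of_append hu
    by_cases h1 : ∃ w0, w = a :: w0
    · obtain ⟨w0, rfl⟩ := h1
      obtain ⟨j, hj, hrot⟩ := ih hu' (w := w0 ++ [a]) (cycReduced_concat.2 (cycReduced_cons.1 hw))
        (by simp) (by simpa using heven) (by
          rw [← h]
          simp [inv_eq_self hr, mul_assoc, involution_mul_cancel_left hr])
      refine ⟨1 + j, ?_, ?_⟩
      · simp [Nat.even_add, hj]
      · rw [hrot, ← List.rotate_rotate]
        simp
    by_cases h2 : ∃ w0, w = w0 ++ [a]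
    · obtain ⟨w0, rfl⟩ := h2
      obtain ⟨j, hj, hrot⟩ := ih hu' (w := a :: w0) (cycReduced_cons.2 (cycReduced_concat.1 hw))
        (by simp) (by simpa using heven) (by
          rw [← h]
          simp [inv_eq_self hr, mul_assoc, involution_mul_cancel_left hr])
      refine ⟨w0.length + j, ?_, ?_⟩
      · simp only [List.length_append, List.length_singleton] at heven ⊢
        rw [Nat.even_add, hj, Nat.even_add_one]
        rw [Nat.even_add_one] at heven
        tauto
      · rw [hrot, ← List.rotate_rotate, List.rotate_append_length_eq]
        simp
    exfalso
    have hred : Reduced (u ++ a :: (w ++ a :: u.reverse)) := by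
      obtain ⟨b, w1, rfl⟩ := List.exists_cons_of_ne_nil hne
      have hba : a ≠ b := fun hab => h1 ⟨w1, by rw [hab]⟩
      obtain ⟨w2, c, hc⟩ : ∃ w2 c, b :: w1 = w2 ++ [c] :=
        ⟨_, _, (List.dropLast_append_getLast (List.cons_ne_nil b w1)).symm⟩
      have hca : c ≠ a := fun hca => h2 ⟨w2, by rw [hc, hca]⟩
      have hr' : Reduced (a :: u.reverse) := by
        rw [← reduced_reverse]
        simpa using hu
      refine List.isChain_split.2 ⟨hu, ?_⟩
      rw [List.cons_append, List.isChain_cons_cons]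
      refine ⟨hba, ?_⟩
      rw [← List.cons_append, hc, List.append_assoc, List.singleton_append,
        List.isChain_append_cons_cons, ← hc]
      exact ⟨hw.reduced, hca, hr'⟩
    have heq : w' = u ++ a :: (w ++ a :: u.reverse) := by
      refine wordProd_injOn_reduced hr hfree hw'.reduced hred ?_
      rw [← h]
      simp [wordProd_reverse hr, inv_eq_self hr, mul_assoc]
    have hcyc : CycReduced (u ++ a :: (w ++ a :: u.reverse)) := heq ▸ hw'
    rcases u with _ | ⟨d, u⟩
    · simp only [List.nil_append, List.reverse_nil] at hcyc
      rw [← List.cons_append, cycReduced_concat] at hcyc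
      simp [Reduced] at hcyc
    · have : (d :: u) ++ a :: (w ++ a :: (d :: u).reverse) =
          (d :: (u ++ a :: (w ++ a :: u.reverse))) ++ [d] := by simp
      rw [this, cycReduced_concat] at hcyc
      simp [Reduced] at hcyc

/-- Every word can be made reduced without changing its product or the parity of its length. -/
lemma exists_reduced {r : ι → G} (hr : ∀ i, r i * r i = 1) (w : List ι) :
    ∃ v, Reduced v ∧ wordProd r v = wordProd r w ∧ v.length ≤ w.length ∧
      (Even v.length ↔ Even w.length) := by
  classical
  induction w with
  | nil => exact ⟨[], by simp, rfl, le_rfl, Iff.rfl⟩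
  | cons a w ih =>
    obtain ⟨v, hv, hp, hl, he⟩ := ih
    by_cases h : ∃ v0, v = a :: v0
    · obtain ⟨v0, rfl⟩ := h
      refine ⟨v0, hv.tail, ?_, ?_, ?_⟩
      · rw [wordProd_cons, ← hp, wordProd_cons, ← mul_assoc, hr, one_mul]
      · simp only [List.length_cons] at hl ⊢
        omega
      · simp only [List.length_cons, Nat.even_add_one] at he ⊢
        tauto
    · refine ⟨a :: v, ?_, by simp [hp], by simpa using hl, by simp [Nat.even_add_one, he]⟩
      cases v with
      | nil => simp
      | cons b v =>
        exact List.isChain_cons_cons.2 ⟨fun hab => h ⟨v, by rw [hab]⟩, hv⟩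

lemma exists_eq_cons_append_of_not_cycReduced {v : List ι} (hv : Reduced v) (he : Even v.length)
    (hc : ¬ CycReduced v) : ∃ a w, v = a :: (w ++ [a]) := by
  rcases v with _ | ⟨a, v⟩
  · exact absurd (by simp [CycReduced]) hc
  rcases List.eq_nil_or_concat v with rfl | ⟨v, d, rfl⟩
  · simp at he
  refine ⟨a, v, ?_⟩
  rw [List.concat_eq_append] at *
  by_contra hne
  have hne' : d ≠ a := fun h => hne (by rw [h])
  refine hc (cycReduced_cons.2 ?_)
  rw [List.append_assoc, List.singleton_append, ← List.cons_append,
    Reduced, List.isChain_append_cons_cons]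
  exact ⟨by simpa using hv, hne', by simp⟩

/-- Every word of even length is conjugate, through a word of even length, to a cyclically reduced
word which is not longer. -/
lemma exists_cycReduced {r : ι → G} (hr : ∀ i, r i * r i = 1) (w : List ι)
    (heven : Even w.length) :
    ∃ v u, CycReduced v ∧ Even v.length ∧ v.length ≤ w.length ∧ Even u.length ∧
      wordProd r v = wordProd r u * wordProd r w * (wordProd r u)⁻¹ := by
  induction hn : w.length using Nat.strong_induction_on generalizing w with
  | _ n ih =>
    obtain ⟨v, hv, hp, hl, he⟩ := exists_reduced hr w
    have hve : Even v.length := he.2 heven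
    by_cases hc : CycReduced v
    · exact ⟨v, [], hc, hve, hn ▸ hl, by simp, by simp [hp]⟩
    obtain ⟨d, v, rfl⟩ := exists_eq_cons_append_of_not_cycReduced hv hve hc
    rcases v with _ | ⟨c, v⟩
    · simp [Reduced] at hv
    simp only [List.length_cons, List.length_append, List.length_nil,
      List.cons_append] at hl hve hp
    obtain ⟨x, u, hx, hxe, hxl, hue, hxu⟩ := ih (v ++ [c]).length (by simp; omega) (v ++ [c]) (by
      simp only [List.length_append, List.length_singleton, Nat.even_add_one] at hve ⊢
      tauto) rfl
    refine ⟨x, u ++ [c, d], hx, hxe, ?_, ?_, ?_⟩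
    · simp only [List.length_append, List.length_singleton] at hxl
      omega
    · simpa [Nat.even_add_one] using hue
    · rw [hxu, ← hp]
      simp [inv_eq_self hr, mul_assoc, involution_mul_cancel_left hr]

end Words

/-! ### Growth of products of reflections -/

/-- The tangent of half the half-width `theta b`. -/
def tanHalf (b : ℝ) : ℝ := (1 - Real.cos (theta b)) / Real.sin (theta b)

lemma sin_theta (b : ℝ) : Real.sin (theta b) = √3 / (2 * Real.cosh (b / 2)) := by
  have hc : 1 ≤ Real.cosh (b / 2) := Real.one_le_cosh _
  have h3 : √3 < 2 := by
    rw [Real.sqrt_lt' (by norm_num)]; norm_num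
  have hp : 0 < √3 / (2 * Real.cosh (b / 2)) := by positivity
  have hl : √3 / (2 * Real.cosh (b / 2)) ≤ 1 := by
    rw [div_le_one (by positivity)]; linarith
  rw [theta, Real.sin_arcsin (by linarith) hl]

lemma sin_theta_pos (b : ℝ) : 0 < Real.sin (theta b) := by
  rw [sin_theta]
  have := Real.cosh_pos (b / 2)
  positivity

lemma cos_theta_nonneg (b : ℝ) : 0 ≤ Real.cos (theta b) := Real.cos_arcsin_nonneg _

lemma cos_theta_lt_one (b : ℝ) : Real.cos (theta b) < 1 := by
  have h1 := sin_theta_pos b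
  have h2 := Real.sin_sq_add_cos_sq (theta b)
  nlinarith [cos_theta_nonneg b]

lemma tanHalf_pos (b : ℝ) : 0 < tanHalf b :=
  div_pos (by linarith [cos_theta_lt_one b]) (sin_theta_pos b)

lemma sin_theta_mul (b : ℝ) : Real.sin (theta b) * (1 + tanHalf b ^ 2) = 2 * tanHalf b := by
  have h1 := (sin_theta_pos b).ne'
  have h2 := Real.sin_sq_add_cos_sq (theta b)
  rw [tanHalf]
  field_simp
  linarith

lemma cos_theta_eq (b : ℝ) : Real.cos (theta b) = 1 - tanHalf b * Real.sin (theta b) := by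
  have h1 := (sin_theta_pos b).ne'
  rw [tanHalf]
  field_simp
  ring

lemma tanHalf_le_one (b : ℝ) : tanHalf b ≤ 1 := by
  rw [tanHalf, div_le_one (sin_theta_pos b)]
  have h2 := Real.sin_sq_add_cos_sq (theta b)
  nlinarith [cos_theta_nonneg b, cos_theta_lt_one b, sin_theta_pos b]

/-- The relation between `tanHalf b` and `exp (-b)`, in a form free of square roots except for the
factor `√3`. -/
lemma tanHalf_relation (b : ℝ) :
    2 * tanHalf b * Real.exp (b / 2) * (1 + Real.exp (-b)) = √3 * (1 + tanHalf b ^ 2) := by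
  have h := sin_theta_mul b
  have hE : Real.exp (b / 2) * Real.exp (-(b / 2)) = 1 := by rw [← Real.exp_add]; simp
  have hb : Real.exp (-b) = Real.exp (-(b / 2)) ^ 2 := by
    rw [← Real.exp_nat_mul]; congr 1; push_cast; ring
  have hc : 2 * Real.cosh (b / 2) = Real.exp (b / 2) * (1 + Real.exp (-b)) := by
    rw [Real.cosh_eq, hb]; linear_combination - Real.exp (-(b / 2)) * hE
  have hpos := Real.cosh_pos (b / 2)
  rw [sin_theta, div_mul_eq_mul_div, div_eq_iff (by positivity), hc] at h
  rw [h]; ring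

/-- The vector with coordinates `a`, `c` in the standard basis rotated by the angle `-f`. For
`f = halfAngle j` this basis is adapted to the reflection number `j`. -/
def adaptedVec (f a c : ℝ) : Fin 2 → ℝ :=
  ![a * Real.cos f + c * Real.sin f, -a * Real.sin f + c * Real.cos f]

lemma adaptedVec_smul (f g a c : ℝ) : adaptedVec f (g * a) (g * c) = g • adaptedVec f a c := by
  ext i
  fin_cases i <;> simp [adaptedVec] <;> ring

lemma adaptedVec_ne_zero (f a : ℝ) : adaptedVec f a 1 ≠ 0 := by
  intro h
  have h0 := congrFun h 0
  have h1 := congrFun h 1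
  simp [adaptedVec] at h0 h1
  have := Real.sin_sq_add_cos_sq f
  exact zero_ne_one (α := ℝ) (by linear_combination this - Real.sin f * h0 - Real.cos f * h1)

/-- In its adapted basis, a reflection exchanges the two coordinates up to the factors `tanHalf b`
and `1 / tanHalf b`. -/
lemma reflMatrix_mulVec_adaptedVec (b f h a c : ℝ) :
    reflMatrix (2 * f) (theta b) *ᵥ adaptedVec h a c =
      adaptedVec f (tanHalf b * (Real.sin (f - h) * a + Real.cos (f - h) * c))
        ((Real.cos (f - h) * a - Real.sin (f - h) * c) / tanHalf b) := by
  have hT := (tanHalf_pos b).ne'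
  have hs := (sin_theta_pos b).ne'
  have hs2 : Real.sin (theta b) = 2 * tanHalf b / (1 + tanHalf b ^ 2) := by
    rw [eq_div_iff (by positivity), sin_theta_mul]
  have hf := Real.sin_sq_add_cos_sq f
  ext i
  fin_cases i <;>
    simp [reflMatrix, adaptedVec, Matrix.mulVec, cos_theta_eq, hs2,
      Real.sin_two_mul, Real.cos_two_mul', Real.sin_sub, Real.cos_sub] <;>
    field_simp
  · linear_combination (1 - tanHalf b ^ 2) * (-(a * Real.sin h) + Real.cos h * c) * hf
  · linear_combination -(1 - tanHalf b ^ 2) * (a * Real.cos h + c * Real.sin h) * hf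

/-- Half of the argument of the direction in which the geodesic number `j` is seen from the centre
of the disc. -/
def halfAngle (j : Fin 3) : ℝ := Real.pi * ((j : ℝ) + 1) / 3

/-- The tangent of the angle between the bases adapted to two different reflections; it has no
meaning for `i = j`. -/
def slope (i j : Fin 3) : ℝ := if i - j = 1 then √3 else -√3

lemma slope_sq (i j : Fin 3) : slope i j ^ 2 = 3 := by
  unfold slope
  split_ifs <;> simp

/-- The product of consecutive slopes tells whether three consecutive letters are distinct. -/
lemma slope_mul_slope {i j k : Fin 3} (hij : i ≠ j) (hjk : j ≠ k) :
    slope i j * slope j k = if i ≠ k then 3 else -3 := by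
  have h3 : √3 * √3 = 3 := Real.mul_self_sqrt (by norm_num)
  have key : i ≠ k ↔ (i - j = 1 ↔ j - k = 1) := by
    revert i j k; decide
  unfold slope
  rw [if_congr key rfl rfl]
  split_ifs <;> first | tauto | simp [h3]

lemma cos_sin_halfAngle_sub {i j : Fin 3} (hij : i ≠ j) :
    ∃ p : ℝ, |p| = 1 / 2 ∧ Real.cos (halfAngle i - halfAngle j) = p ∧
      Real.sin (halfAngle i - halfAngle j) = slope i j * p := by
  have hc2 : Real.cos (2 * (Real.pi / 3)) = -(1 / 2) := by
    rw [Real.cos_two_mul, Real.cos_pi_div_three]; norm_num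
  have hs2 : Real.sin (2 * (Real.pi / 3)) = √3 / 2 := by
    rw [Real.sin_two_mul, Real.cos_pi_div_three, Real.sin_pi_div_three]; ring
  have h1 : ∀ x : ℝ, x = Real.pi / 3 → Real.cos x = 1 / 2 ∧ Real.sin x = √3 * (1 / 2) := by
    rintro x rfl
    exact ⟨Real.cos_pi_div_three, by rw [Real.sin_pi_div_three]; ring⟩
  have h2 : ∀ x : ℝ, x = -(Real.pi / 3) → Real.cos x = 1 / 2 ∧ Real.sin x = -√3 * (1 / 2) := by
    rintro x rfl
    rw [Real.cos_neg, Real.sin_neg]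
    exact ⟨Real.cos_pi_div_three, by rw [Real.sin_pi_div_three]; ring⟩
  have h3 : ∀ x : ℝ, x = 2 * (Real.pi / 3) →
      Real.cos x = -(1 / 2) ∧ Real.sin x = -√3 * -(1 / 2) := by
    rintro x rfl
    exact ⟨hc2, by rw [hs2]; ring⟩
  have h4 : ∀ x : ℝ, x = -(2 * (Real.pi / 3)) →
      Real.cos x = -(1 / 2) ∧ Real.sin x = √3 * -(1 / 2) := by
    rintro x rfl
    rw [Real.cos_neg, Real.sin_neg]
    exact ⟨hc2, by rw [hs2]; ring⟩
  revert hij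
  have habs : |(1 / 2 : ℝ)| = 1 / 2 := by norm_num
  have habs' : |(-(1 / 2) : ℝ)| = 1 / 2 := by norm_num
  have key : (i, j) ∈ [((1 : Fin 3), (0 : Fin 3)), (2, 1), (0, 1), (1, 2), (2, 0), (0, 2)] ∨
      i = j := by
    revert i j; decide
  intro hij
  have e1 : ((0 : Fin 3) - 1 = 1) = False := by decide
  have e2 : ((1 : Fin 3) - 2 = 1) = False := by decide
  have e3 : ((2 : Fin 3) - 0 = 1) = False := by decide
  have e4 : ((0 : Fin 3) - 2 = 1) = True := by decide
  have e5 : ((2 : Fin 3) - 1 = 1) = True := by decide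
  have e6 : ((1 : Fin 3) - 0 = 1) = True := by decide
  rcases key with key | key
  · simp only [List.mem_cons, Prod.mk.injEq, List.not_mem_nil, or_false] at key
    rcases key with ⟨rfl, rfl⟩ | ⟨rfl, rfl⟩ | ⟨rfl, rfl⟩ | ⟨rfl, rfl⟩ | ⟨rfl, rfl⟩ | ⟨rfl, rfl⟩ <;>
      simp only [slope, e1, e2, e3, e4, e5, e6, if_true, if_false]
    · exact ⟨1 / 2, habs, h1 _ (by simp [halfAngle]; ring)⟩
    · exact ⟨1 / 2, habs, h1 _ (by simp [halfAngle]; ring)⟩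
    · exact ⟨1 / 2, habs, h2 _ (by simp [halfAngle]; ring)⟩
    · exact ⟨1 / 2, habs, h2 _ (by simp [halfAngle]; ring)⟩
    · exact ⟨-(1 / 2), habs', h3 _ (by simp [halfAngle]; ring)⟩
    · exact ⟨-(1 / 2), habs', h4 _ (by simp [halfAngle]; ring)⟩
  · exact absurd key hij

/-- The action of a reflection on directions, in coordinates adapted to the letters before and
after the reflection; `κ` is the slope between the two letters. The coordinate of a direction is the
quotient of the coordinates used in `adaptedVec`. -/
def coneMap (b κ u : ℝ) : ℝ := tanHalf b ^ 2 * (κ * u + 1) / (u - κ)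

/-- A reflection acts on directions by `coneMap`; the absolute value of `g` is the factor by which
it stretches the normalized vectors. -/
lemma refl_mulVec (b : ℝ) {i j : Fin 3} (hij : i ≠ j) {u : ℝ} (hu : u - slope i j ≠ 0) :
    ∃ g : ℝ, |g| = |u - slope i j| / (2 * tanHalf b) ∧
      (refl b i : Matrix (Fin 2) (Fin 2) ℝ) *ᵥ adaptedVec (halfAngle j) u 1 =
        g • adaptedVec (halfAngle i) (coneMap b (slope i j) u) 1 := by
  obtain ⟨p, hp, hc, hs⟩ := cos_sin_halfAngle_sub hij
  have hT := tanHalf_pos b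
  refine ⟨p * (u - slope i j) / tanHalf b, ?_, ?_⟩
  · rw [abs_div, abs_mul, hp, abs_of_pos hT]
    field_simp
  · have h1 : (refl b i : Matrix (Fin 2) (Fin 2) ℝ) =
        reflMatrix (2 * halfAngle i) (theta b) := by
      simp only [refl, halfAngle]
      congr 1
      ring
    rw [h1, reflMatrix_mulVec_adaptedVec, ← adaptedVec_smul, hc, hs, coneMap]
    congr 1
    · field_simp
    · ring

/-- For large `b`, `tan ^ 2 (θ / 2)` is `3 / 4 * exp (-b)` up to second order. -/
lemma tanHalf_sq_bounds {b : ℝ} (ha : Real.exp (-b) ≤ 1 / 100) :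
    tanHalf b ^ 2 ≤ Real.exp (-b) ∧
      |tanHalf b ^ 2 - 3 / 4 * Real.exp (-b)| ≤ 2 * Real.exp (-b) ^ 2 := by
  have hrel := tanHalf_relation b
  have hT := tanHalf_pos b
  have hT1 := tanHalf_le_one b
  have hE : Real.exp (b / 2) ^ 2 * Real.exp (-b) = 1 := by
    rw [← Real.exp_nat_mul, ← Real.exp_add]; simp; ring_nf
  have hapos := Real.exp_pos (-b)
  have h3 : √3 ^ 2 = 3 := Real.sq_sqrt (by norm_num)
  have hsq : 4 * tanHalf b ^ 2 * (1 + Real.exp (-b)) ^ 2 =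
      3 * (1 + tanHalf b ^ 2) ^ 2 * Real.exp (-b) := by
    have := congrArg (fun x => x ^ 2 * Real.exp (-b)) hrel
    simp only [mul_pow, h3] at this
    linear_combination this - 4 * tanHalf b ^ 2 * (1 + Real.exp (-b)) ^ 2 * hE
  generalize Real.exp (-b) = a at *
  have ht0 : 0 < tanHalf b ^ 2 := by positivity
  have ht1 : tanHalf b ^ 2 ≤ 1 := by nlinarith
  generalize tanHalf b ^ 2 = τ at *
  have h1 : τ ≤ 3 * a := by nlinarith [mul_nonneg ht0.le hapos.le, mul_nonneg ht0.le (sq_nonneg a)]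
  have h2 : τ ≤ a := by
    have : (1 + τ) ^ 2 ≤ 1.07 := by nlinarith
    nlinarith [mul_nonneg ht0.le hapos.le, mul_nonneg ht0.le (sq_nonneg a)]
  refine ⟨h2, abs_le.2 ⟨?_, ?_⟩⟩
  · nlinarith [mul_nonneg ht0.le hapos.le, mul_nonneg ht0.le (sq_nonneg a), mul_pos hapos hapos]
  · nlinarith [mul_nonneg ht0.le hapos.le, mul_nonneg ht0.le (sq_nonneg a), mul_pos hapos hapos]

lemma abs_sub_slope_lower {b κ u : ℝ} (ha : Real.exp (-b) ≤ 1 / 100) (hκ : κ ^ 2 = 3)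
    (hu : |u| ≤ tanHalf b ^ 2) : 3 / 2 ≤ |u - κ| := by
  have h1 : 17 / 10 ≤ |κ| := by
    refine abs_le_of_sq_le_sq' ?_ (abs_nonneg _) |>.2
    rw [sq_abs, hκ]; norm_num
  have h2 := abs_sub_abs_le_abs_sub κ u
  rw [abs_sub_comm u κ]
  linarith [(tanHalf_sq_bounds ha).1]

/-- The cone `|u| ≤ tanHalf b ^ 2` is preserved. -/
lemma abs_coneMap_le {b κ u : ℝ} (ha : Real.exp (-b) ≤ 1 / 100) (hκ : κ ^ 2 = 3)
    (hu : |u| ≤ tanHalf b ^ 2) : |coneMap b κ u| ≤ tanHalf b ^ 2 := by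
  have h1 := abs_sub_slope_lower ha hκ hu
  have h2 : |κ| ≤ 2 := by
    refine abs_le_of_sq_le_sq' ?_ (by norm_num) |>.2
    rw [sq_abs, hκ]; norm_num
  have h3 : |κ * u + 1| ≤ 3 / 2 := by
    refine (abs_add_le _ _).trans ?_
    rw [abs_mul, abs_one]
    have := (tanHalf_sq_bounds ha).1
    nlinarith [abs_nonneg κ, abs_nonneg u]
  rw [coneMap, abs_div, abs_mul, abs_of_nonneg (sq_nonneg (tanHalf b)), div_le_iff₀ (by linarith)]
  exact mul_le_mul_of_nonneg_left (h3.trans h1) (sq_nonneg _)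

/-- The elementary estimate behind `log_growth`, with `a = exp (-b)` and `τ = tan ^ 2 (θ / 2)`. -/
lemma log_growth_aux {a τ w c : ℝ} (hapos : 0 < a) (ha : a ≤ 1 / 100) (ht0 : 0 < τ) (ht1 : τ ≤ a)
    (ht2 : |τ - 3 / 4 * a| ≤ 2 * a ^ 2) (hwabs : |w| ≤ 2 * τ) (hc' : c = 0 ∨ c = 1) :
    0 < 1 + (2 * c - 1) * τ * (1 + w) / (3 - w) ∧
    0 < (1 + a) / (1 + τ) * (1 + (2 * c - 1) * τ * (1 + w) / (3 - w)) ∧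
    |2 * Real.log ((1 + a) / (1 + τ) * (1 + (2 * c - 1) * τ * (1 + w) / (3 - w))) - c * a| ≤
      20 * a ^ 2 := by
  have haa : a ^ 2 ≤ a / 100 := by nlinarith
  obtain ⟨hw1, hw2⟩ := abs_le.1 hwabs
  have hw3 : 0 < 3 - w := by linarith
  set Y := 1 + (2 * c - 1) * τ * (1 + w) / (3 - w) with hY
  have hYabs : |Y - 1 - (2 * c - 1) * a / 4| ≤ 2 * a ^ 2 := by
    have hfrac : Y - 1 = (2 * c - 1) * (τ / 3 + τ * (4 * w / 3) / (3 - w)) := by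
      rw [hY]; field_simp; ring
    have hsm : |τ * (4 * w / 3) / (3 - w)| ≤ a ^ 2 := by
      rw [abs_div, abs_mul, abs_of_pos ht0, abs_of_pos hw3, div_le_iff₀ hw3, abs_div, abs_mul]
      norm_num
      have h1 : τ * (4 * |w| / 3) ≤ a * (4 * (2 * a) / 3) :=
        mul_le_mul ht1 (by linarith) (by positivity) hapos.le
      have h2 : a ^ 2 * (8 / 3) ≤ a ^ 2 * (3 - w) :=
        mul_le_mul_of_nonneg_left (by linarith) (sq_nonneg a)
      linarith
    obtain ⟨q1, q2⟩ := abs_le.1 hsm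
    obtain ⟨t1, t2⟩ := abs_le.1 ht2
    generalize τ * (4 * w / 3) / (3 - w) = q at *
    rcases hc' with rfl | rfl <;> rw [hfrac, abs_le] <;> constructor <;> linarith
  have hYpos : 0 < Y := by
    obtain ⟨q1, q2⟩ := abs_le.1 hYabs
    rcases hc' with rfl | rfl <;> linarith
  set y := (1 + a) / (1 + τ) * Y with hy
  have hyabs : |y - 1 - c * a / 2| ≤ 7 * a ^ 2 := by
    have hfrac : (1 + a) / (1 + τ) = 1 + (a - τ) - (a - τ) * τ / (1 + τ) := by
      field_simp; ring
    have hsm : |(a - τ) * τ / (1 + τ)| ≤ a ^ 2 := by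
      rw [abs_of_nonneg (div_nonneg (mul_nonneg (by linarith) ht0.le) (by linarith)),
        div_le_iff₀ (by linarith)]
      nlinarith
    have hq : |(1 + a) / (1 + τ) - 1 - a / 4| ≤ 3 * a ^ 2 := by
      rw [hfrac]
      obtain ⟨q1, q2⟩ := abs_le.1 hsm
      obtain ⟨t1, t2⟩ := abs_le.1 ht2
      rw [abs_le]
      constructor <;> linarith
    rw [hy]
    obtain ⟨q1, q2⟩ := abs_le.1 hq
    obtain ⟨r1, r2⟩ := abs_le.1 hYabs
    clear_value Y
    generalize (1 + a) / (1 + τ) = Q at *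
    have e : Q * Y - 1 - c * a / 2 = (Q - 1 - a / 4) + (Y - 1 - (2 * c - 1) * a / 4) +
        (Q - 1) * (Y - 1) := by ring
    have hprod : |(Q - 1) * (Y - 1)| ≤ a ^ 2 := by
      have k1 : |Q - 1| ≤ a := by rw [abs_le]; constructor <;> linarith
      have k2 : |Y - 1| ≤ a := by
        rw [abs_le]
        rcases hc' with rfl | rfl <;> constructor <;> linarith
      rw [abs_mul, pow_two]
      exact mul_le_mul k1 k2 (abs_nonneg _) hapos.le
    obtain ⟨p1, p2⟩ := abs_le.1 hprod
    rw [e, abs_le]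
    constructor <;> linarith
  obtain ⟨y1, y2⟩ := abs_le.1 hyabs
  have hypos : 1 / 2 ≤ y := by
    rcases hc' with rfl | rfl <;> linarith
  have hup := Real.log_le_sub_one_of_pos (show 0 < y by linarith)
  have hlo : 1 - y⁻¹ ≤ Real.log y := Real.one_sub_inv_le_log_of_pos (by linarith)
  have hlo' : (y - 1) - 2 * (y - 1) ^ 2 ≤ 1 - y⁻¹ := by
    have : 1 - y⁻¹ = (y - 1) - (y - 1) ^ 2 * y⁻¹ := by field_simp; ring
    rw [this]
    have hinv : y⁻¹ ≤ 2 := by rw [inv_le_comm₀ (by linarith) (by norm_num)]; linarith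
    nlinarith [sq_nonneg (y - 1)]
  have hy3 : (y - 1) ^ 2 ≤ a ^ 2 := by
    rw [sq_le_sq, abs_of_pos hapos, abs_le]
    rcases hc' with rfl | rfl <;> constructor <;> linarith
  refine ⟨hYpos, by linarith, ?_⟩
  rw [abs_le]
  constructor <;> linarith

/-- The logarithmic growth under one reflection: `b` to leading order, with a correction `exp (-b)`
when three consecutive letters are distinct (that is, when consecutive slopes agree). -/
lemma log_growth {b κ κ' v c : ℝ} (ha : Real.exp (-b) ≤ 1 / 100) (hκ : κ ^ 2 = 3)
    (hκ' : κ' ^ 2 = 3) (hc : κ * κ' = 6 * c - 3) (hc' : c = 0 ∨ c = 1)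
    (hv : |v| ≤ tanHalf b ^ 2) :
    |2 * Real.log (|coneMap b κ' v - κ| / (2 * tanHalf b)) - b - c * Real.exp (-b)| ≤
      20 * Real.exp (-b) ^ 2 := by
  obtain ⟨ht1, ht2⟩ := tanHalf_sq_bounds ha
  have hrel := tanHalf_relation b
  have hT := tanHalf_pos b
  have hE := Real.exp_pos (b / 2)
  have hapos := Real.exp_pos (-b)
  have hu := abs_coneMap_le ha hκ' hv
  have hsl := abs_sub_slope_lower ha hκ' hv
  have hs3 : √3 ^ 2 = 3 := Real.sq_sqrt (by norm_num)
  have hs3p : 0 < √3 := by positivity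
  have hκabs : |κ| = √3 := by rw [← Real.sqrt_sq_eq_abs, hκ]
  set τ := tanHalf b ^ 2 with hτ
  have ht0 : 0 < τ := by positivity
  set a := Real.exp (-b) with hadef
  set w := κ' * v with hw
  have hwabs : |w| ≤ 2 * τ := by
    rw [hw, abs_mul]
    have h2 : |κ'| ≤ 2 := by
      refine abs_le_of_sq_le_sq' ?_ (by norm_num) |>.2
      rw [sq_abs, hκ']; norm_num
    nlinarith [abs_nonneg κ', abs_nonneg v]
  obtain ⟨hw1, hw2⟩ := abs_le.1 hwabs
  have hw3 : 0 < 3 - w := by linarith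
  obtain ⟨hYpos, hypos, hlog⟩ := log_growth_aux hapos ha ht0 ht1 ht2 hwabs hc'
  set Y := 1 + (2 * c - 1) * τ * (1 + w) / (3 - w) with hY
  have habs : |coneMap b κ' v - κ| = √3 * Y := by
    have hne : v - κ' ≠ 0 := by
      intro h0
      rw [h0, abs_zero] at hsl
      norm_num at hsl
    have hne' : κ' ≠ 0 := by
      rintro rfl
      norm_num at hκ'
    have h1 : κ * (coneMap b κ' v - κ) = -(3 * Y) := by
      have e1 : κ' * (v - κ') = -(3 - w) := by rw [hw]; linear_combination -hκ'
      have e2 : coneMap b κ' v = -(κ' * τ * (w + 1) / (3 - w)) := by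
        rw [coneMap, ← hτ, ← hw, div_eq_iff hne, neg_mul, div_mul_eq_mul_div, eq_comm,
          neg_eq_iff_eq_neg, div_eq_iff hw3.ne']
        linear_combination (τ * (w + 1)) * e1
      have e3 : κ * coneMap b κ' v = -((κ * κ') * τ * (w + 1) / (3 - w)) := by rw [e2]; ring
      rw [mul_sub, e3, hc, hY]
      linear_combination -hκ
    have h2 : √3 * |coneMap b κ' v - κ| = 3 * Y := by
      rw [← hκabs, ← abs_mul, h1, abs_neg, abs_of_pos (by positivity)]
    have h3 : √3 * |coneMap b κ' v - κ| = √3 * (√3 * Y) := by rw [h2]; linear_combination -Y * hs3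
    exact mul_left_cancel₀ hs3p.ne' h3
  -- The quotient of the growth by `exp (b / 2)` is `y`.
  set y := (1 + a) / (1 + τ) * Y with hy
  have hgrowth : |coneMap b κ' v - κ| / (2 * tanHalf b) = Real.exp (b / 2) * y := by
    rw [habs, hy, div_eq_iff (by positivity)]
    field_simp
    linear_combination -hrel
  have hlog' : 2 * Real.log (Real.exp (b / 2) * y) - b - c * a = 2 * Real.log y - c * a := by
    rw [Real.log_mul hE.ne' hypos.ne', Real.log_exp]; ring
  rw [hgrowth, hlog']
  exact hlog

/-! ### Eigenvalues along periodic sequences -/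

/-- The shift of a sequence by one letter. -/
def shift {ι : Type*} (x : ℕ → ι) : ℕ → ι := fun i => x (i + 1)

/-- The word of the first `n` letters of a sequence. -/
def seqWord {ι : Type*} (x : ℕ → ι) (n : ℕ) : List ι := (List.range n).map x

@[simp] lemma seqWord_zero {ι : Type*} (x : ℕ → ι) : seqWord x 0 = [] := rfl

lemma seqWord_succ {ι : Type*} (x : ℕ → ι) (n : ℕ) :
    seqWord x (n + 1) = x 0 :: seqWord (shift x) n := by
  simp [seqWord, List.range_succ_eq_map, shift, Function.comp_def]

@[simp] lemma length_seqWord {ι : Type*} (x : ℕ → ι) (n : ℕ) : (seqWord x n).length = n := by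
  simp [seqWord]

/-- A sequence is admissible if no two consecutive letters agree. -/
def Admissible {ι : Type*} (x : ℕ → ι) : Prop := ∀ i, x i ≠ x (i + 1)

/-- The number of positions `i < n` at which three consecutive letters are distinct. -/
def turns (x : ℕ → Fin 3) (n : ℕ) : ℕ := ((Finset.range n).filter fun i => x i ≠ x (i + 2)).card

lemma turns_succ (x : ℕ → Fin 3) (n : ℕ) :
    turns x (n + 1) = turns (shift x) n + if x 0 ≠ x 2 then 1 else 0 := by
  simp only [turns, Finset.card_filter]
  rw [Finset.sum_range_succ']
  rfl

lemma turns_le (x : ℕ → Fin 3) (n : ℕ) : turns x n ≤ n := by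
  simpa [turns] using Finset.card_filter_le (Finset.range n) fun i => x i ≠ x (i + 2)

/-- The composition of the maps `coneMap` along the first `n` steps of a sequence. -/
def coneIter (b : ℝ) : ℕ → (ℕ → Fin 3) → ℝ → ℝ
  | 0, _, u => u
  | n + 1, x, u => coneMap b (slope (x 0) (x 1)) (coneIter b n (shift x) u)

lemma abs_coneIter_le {b : ℝ} (ha : Real.exp (-b) ≤ 1 / 100) (n : ℕ) (x : ℕ → Fin 3) {u : ℝ}
    (hu : |u| ≤ tanHalf b ^ 2) : |coneIter b n x u| ≤ tanHalf b ^ 2 := by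
  induction n generalizing x with
  | zero => exact hu
  | succ n ih => exact abs_coneMap_le ha (slope_sq _ _) (ih _)

lemma continuousOn_coneIter {b : ℝ} (ha : Real.exp (-b) ≤ 1 / 100) (n : ℕ) (x : ℕ → Fin 3) :
    ContinuousOn (coneIter b n x) (Set.Icc (-tanHalf b ^ 2) (tanHalf b ^ 2)) := by
  induction n generalizing x with
  | zero => exact continuousOn_id
  | succ n ih =>
    have h := ih (shift x)
    refine ContinuousOn.div (by fun_prop) (by fun_prop) fun u hu h0 => ?_
    have := abs_sub_slope_lower ha (slope_sq (x 0) (x 1))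
      (abs_coneIter_le ha n (shift x) (abs_le.2 hu))
    rw [h0, abs_zero] at this
    norm_num at this

/-- Along an admissible sequence the logarithmic growth is, up to an error that is of second order
and additive in the length, determined by the number of turns. The initial direction `u` has to lie
in the image of a preceding step, since the growth in a step depends on three consecutive
letters. -/
lemma exists_growth {b : ℝ} (ha : Real.exp (-b) ≤ 1 / 100) (n : ℕ) {x : ℕ → Fin 3}
    (hx : Admissible x) {u v : ℝ} (hv : |v| ≤ tanHalf b ^ 2)
    (hu : u = coneMap b (slope (x n) (x (n + 1))) v) :
    ∃ μ : ℝ, μ ≠ 0 ∧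
      (wordProd (refl b) (seqWord x n)).val *ᵥ
        adaptedVec (halfAngle (x n)) u 1 =
          μ • adaptedVec (halfAngle (x 0)) (coneIter b n x u) 1 ∧
      |2 * Real.log |μ| - n * b - turns x n * Real.exp (-b)| ≤ n * (20 * Real.exp (-b) ^ 2) := by
  induction n generalizing x with
  | zero => exact ⟨1, one_ne_zero, by simp [coneIter], by simp [turns]⟩
  | succ n ih =>
    obtain ⟨μ, hμ0, hμ, hlog⟩ := ih (x := shift x) (fun i => hx (i + 1)) hu
    have hu' : |u| ≤ tanHalf b ^ 2 := hu ▸ abs_coneMap_le ha (slope_sq _ _) hv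
    set w := coneIter b n (shift x) u with hw
    have hwle : |w| ≤ tanHalf b ^ 2 := abs_coneIter_le ha n _ hu'
    obtain ⟨v', hv', hwv⟩ : ∃ v', |v'| ≤ tanHalf b ^ 2 ∧ w = coneMap b (slope (x 1) (x 2)) v' := by
      cases n with
      | zero => exact ⟨v, hv, hu⟩
      | succ n => exact ⟨_, abs_coneIter_le ha n (shift (shift x)) hu', rfl⟩
    have hlow := abs_sub_slope_lower ha (slope_sq (x 0) (x 1)) hwle
    have hne : w - slope (x 0) (x 1) ≠ 0 := by
      intro h0
      rw [h0, abs_zero] at hlow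
      norm_num at hlow
    obtain ⟨g, hg, hgv⟩ := refl_mulVec b (hx 0) hne
    have hg0 : g ≠ 0 := by
      rw [← abs_pos, hg]
      have := tanHalf_pos b
      positivity
    have hstep := log_growth (c := if x 0 ≠ x 2 then 1 else 0) ha (slope_sq (x 0) (x 1))
      (slope_sq (x 1) (x 2)) (by rw [slope_mul_slope (hx 0) (hx 1)]; split_ifs <;> norm_num)
      (by split_ifs <;> simp) hv'
    rw [← hwv, ← hg] at hstep
    refine ⟨g * μ, mul_ne_zero hg0 hμ0, ?_, ?_⟩
    · rw [seqWord_succ, wordProd_cons, Units.val_mul, ← Matrix.mulVec_mulVec]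
      have hμ' : (wordProd (refl b) (seqWord (shift x) n)).val *ᵥ
          adaptedVec (halfAngle (x (n + 1))) u 1 = μ • adaptedVec (halfAngle (x 1)) w 1 := hμ
      rw [hμ', Matrix.mulVec_smul, hgv, smul_smul, mul_comm μ g]
      rfl
    · rw [abs_mul, Real.log_mul (abs_ne_zero.2 hg0) (abs_ne_zero.2 hμ0), turns_succ]
      push_cast
      rw [abs_le] at hstep hlog ⊢
      constructor <;> linarith [hstep.1, hstep.2, hlog.1, hlog.2]

/-- A periodic admissible sequence gives a product of reflections with an eigenvalue whose size is
known to second order: by the intermediate value theorem, the composed cone map has a fixed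
point. -/
lemma exists_eigenvalue {b : ℝ} (ha : Real.exp (-b) ≤ 1 / 100) {n : ℕ} (hn : n ≠ 0)
    {x : ℕ → Fin 3} (hx : Admissible x) (hper : Function.Periodic x n) :
    ∃ μ : ℝ, μ ≠ 0 ∧
      (∃ v : Fin 2 → ℝ, v ≠ 0 ∧
        (wordProd (refl b) (seqWord x n)).val *ᵥ v = μ • v) ∧
      |2 * Real.log |μ| - n * b - turns x n * Real.exp (-b)| ≤ n * (20 * Real.exp (-b) ^ 2) := by
  have hτ : -tanHalf b ^ 2 ≤ tanHalf b ^ 2 := by nlinarith [sq_nonneg (tanHalf b)]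
  obtain ⟨u, hu, hfix⟩ := exists_mem_Icc_isFixedPt_of_mapsTo (continuousOn_coneIter ha n x) hτ
    fun u hu => abs_le.1 (abs_coneIter_le ha n x (abs_le.2 hu))
  have hu' : |u| ≤ tanHalf b ^ 2 := abs_le.2 hu
  obtain ⟨m, rfl⟩ := Nat.exists_eq_succ_of_ne_zero hn
  have h0 : x (m + 1) = x 0 := by simpa using hper 0
  have h1 : x (m + 1 + 1) = x 1 := by simpa [add_comm] using hper 1
  obtain ⟨μ, hμ0, hμ, hlog⟩ := exists_growth ha (m + 1) hx
    (v := coneIter b m (shift x) u) (u := u) (abs_coneIter_le ha m _ hu') (by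
      rw [h0, h1]; exact hfix.symm)
  refine ⟨μ, hμ0, ⟨_, adaptedVec_ne_zero (halfAngle (x 0)) u, ?_⟩, hlog⟩
  rw [h0, show coneIter b (m + 1) x u = u from hfix] at hμ
  exact hμ

/-! ### Translation lengths -/

/-- The displacement function of an isometry; the square vanishes exactly on the axis. -/
lemma cosh_dist_smul (g : GL (Fin 2) ℝ) (hg : g.val.det = 1) (z : ℍ) :
    Real.cosh (dist z (g • z)) = g.val.trace ^ 2 / 2 - 1 +
      (g 1 0 * (z.re ^ 2 + z.im ^ 2) + (g 1 1 - g 0 0) * z.re - g 0 1) ^ 2 / (2 * z.im ^ 2) := by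
  have hdet : g.det.val = 1 := hg
  have hy : z.im ≠ 0 := z.im_ne_zero
  have hden := denom_ne_zero g z
  have hN : Complex.normSq (denom g z) ≠ 0 := fun h => hden (Complex.normSq_eq_zero.1 h)
  have hdist : dist (z : ℂ) ((g • z : ℍ) : ℂ) ^ 2 =
      Complex.normSq (z * denom g z - num g z) / Complex.normSq (denom g z) := by
    rw [coe_smul_of_det_pos (by rw [hdet]; norm_num), Complex.dist_eq, Complex.sq_norm,
      ← Complex.normSq_div, sub_div, mul_div_cancel_right₀ _ hden]
  have hQ : Complex.normSq (z * denom g z - num g z) =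
      (g 1 0 * (z.re ^ 2 + z.im ^ 2) + (g 1 1 - g 0 0) * z.re - g 0 1) ^ 2 +
        z.im ^ 2 * (g.val.trace ^ 2 - 4) := by
    rw [Matrix.det_fin_two] at hg
    simp only [denom, num, Complex.normSq_apply, Matrix.trace_fin_two, Complex.sub_re,
      Complex.mul_re, Complex.add_re, Complex.ofReal_re, Complex.ofReal_im, Complex.sub_im,
      Complex.mul_im, Complex.add_im, UpperHalfPlane.coe_re, UpperHalfPlane.coe_im]
    linear_combination (-4 * z.im ^ 2) * hg
  rw [cosh_dist, hdist, hQ, im_smul_eq_div_normSq, hdet, abs_one, one_mul]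
  field_simp
  ring

/-- The least displacement of a hyperbolic isometry; it is attained on the axis. -/
lemma isLeast_dist_smul (g : GL (Fin 2) ℝ) (hg : g.val.det = 1) {L : ℝ}
    (hL : 0 < L) (htr : g.val.trace ^ 2 / 2 - 1 = Real.cosh L) :
    IsLeast {d : ℝ | ∃ z : ℍ, d = dist z (g • z)} L := by
  constructor
  · have h1 : 1 < Real.cosh L := Real.one_lt_cosh.2 hL.ne'
    obtain ⟨z, hz⟩ : ∃ z : ℍ,
        g 1 0 * (z.re ^ 2 + z.im ^ 2) + (g 1 1 - g 0 0) * z.re - g 0 1 = 0 := by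
      rw [← htr, Matrix.trace_fin_two] at h1
      rw [Matrix.det_fin_two] at hg
      by_cases hc : g 1 0 = 0
      · have hne : g 1 1 - g 0 0 ≠ 0 := by
          intro h0
          rw [hc] at hg
          nlinarith
        refine ⟨⟨⟨g 0 1 / (g 1 1 - g 0 0), 1⟩, one_pos⟩, ?_⟩
        simp only [hc, zero_mul, zero_add]
        change (g 1 1 - g 0 0) * (g 0 1 / (g 1 1 - g 0 0)) - g 0 1 = 0
        field_simp
        ring
      · have hpos : 0 < ((g 0 0 + g 1 1) ^ 2 - 4) / (4 * g 1 0 ^ 2) := by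
          have : 0 < g 1 0 ^ 2 := by positivity
          exact div_pos (by linarith) (by linarith)
        refine ⟨⟨⟨(g 0 0 - g 1 1) / (2 * g 1 0), √(((g 0 0 + g 1 1) ^ 2 - 4) / (4 * g 1 0 ^ 2))⟩,
          Real.sqrt_pos.2 hpos⟩, ?_⟩
        change g 1 0 * (((g 0 0 - g 1 1) / (2 * g 1 0)) ^ 2 +
          √(((g 0 0 + g 1 1) ^ 2 - 4) / (4 * g 1 0 ^ 2)) ^ 2) +
          (g 1 1 - g 0 0) * ((g 0 0 - g 1 1) / (2 * g 1 0)) - g 0 1 = 0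
        rw [Real.sq_sqrt hpos.le]
        field_simp
        linear_combination 16 * hg
    refine ⟨z, ?_⟩
    have := cosh_dist_smul g hg z
    rw [hz, htr] at this
    have h2 : Real.cosh (dist z (g • z)) = Real.cosh L := by rw [this]; simp
    exact (Real.cosh_injOn dist_nonneg hL.le h2).symm
  · rintro d ⟨z, rfl⟩
    have h1 : Real.cosh L ≤ Real.cosh (dist z (g • z)) := by
      rw [cosh_dist_smul g hg z, htr]
      have : 0 ≤ (g 1 0 * (z.re ^ 2 + z.im ^ 2) + (g 1 1 - g 0 0) * z.re - g 0 1) ^ 2 /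
        (2 * z.im ^ 2) := by positivity
      linarith
    rw [Real.cosh_le_cosh, abs_of_pos hL, abs_of_nonneg dist_nonneg] at h1
    exact h1

/-- The eigenvalue of a matrix of determinant one determines the translation length. -/
lemma cosh_two_mul_log_abs {M : Matrix (Fin 2) (Fin 2) ℝ} (hM : M.det = 1) {μ : ℝ} (hμ : μ ≠ 0)
    {v : Fin 2 → ℝ} (hv : v ≠ 0) (h : M *ᵥ v = μ • v) :
    M.trace ^ 2 / 2 - 1 = Real.cosh (2 * Real.log |μ|) := by
  have hdet : (M - μ • 1).det = 0 := by
    refine exists_mulVec_eq_zero_iff.1 ⟨v, hv, ?_⟩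
    rw [sub_mulVec, h, smul_mulVec, one_mulVec, sub_self]
  have htr : M.trace * μ = μ ^ 2 + 1 := by
    rw [Matrix.det_fin_two] at hdet hM
    simp [Matrix.trace_fin_two] at hdet ⊢
    linear_combination -hdet + hM
  have hexp : Real.exp (2 * Real.log |μ|) = μ ^ 2 := by
    rw [two_mul, Real.exp_add, Real.exp_log (abs_pos.2 hμ), abs_mul_abs_self, pow_two]
  have htr' : M.trace = (μ ^ 2 + 1) / μ := by rw [← htr, mul_div_cancel_right₀ _ hμ]
  rw [Real.cosh_eq, Real.exp_neg, hexp, htr']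
  field_simp
  ring

/-! ### Periodic sequences and cyclically reduced words -/

section Sequences

variable {ι : Type*}

lemma seqWord_add (x : ℕ → ι) (m n : ℕ) :
    seqWord x (m + n) = seqWord x m ++ seqWord (fun i => x (i + m)) n := by
  simp [seqWord, List.range_add, Function.comp_def, add_comm]

lemma getElem_seqWord (x : ℕ → ι) (n i : ℕ) (h : i < (seqWord x n).length) :
    (seqWord x n)[i] = x i := by simp [seqWord]

lemma reduced_seqWord_iff {x : ℕ → ι} {n : ℕ} :
    Reduced (seqWord x n) ↔ ∀ i, i + 1 < n → x i ≠ x (i + 1) := by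
  simp [Reduced, List.isChain_iff_getElem, getElem_seqWord]

lemma Periodic.shift_eq {x : ℕ → ι} {n : ℕ} (h : Function.Periodic x n) :
    (fun i => x (i + n)) = x := funext h

lemma cycReduced_seqWord {x : ℕ → ι} {n : ℕ} (hx : Admissible x) (h : Function.Periodic x n) :
    CycReduced (seqWord x n) := by
  have : seqWord x n ++ seqWord x n = seqWord x (n + n) := by
    rw [seqWord_add, Periodic.shift_eq h]
  rw [CycReduced, this]
  exact reduced_seqWord_iff.2 fun i _ => hx i

/-- Every nonempty cyclically reduced word is a period of an admissible sequence. -/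
lemma exists_seqWord_eq {v : List ι} (hv : CycReduced v) (hne : v ≠ []) :
    ∃ x : ℕ → ι, Admissible x ∧ Function.Periodic x v.length ∧ seqWord x v.length = v := by
  have hpos : 0 < v.length := List.length_pos_iff.2 hne
  set x : ℕ → ι := fun i => v[i % v.length]'(Nat.mod_lt _ hpos) with hx
  have hper : Function.Periodic x v.length := fun i => by simp [hx]
  have hword : seqWord x v.length = v := by
    refine List.ext_getElem (by simp) fun i h1 h2 => ?_
    simp [getElem_seqWord, hx, Nat.mod_eq_of_lt h2]
  refine ⟨x, fun i => ?_, hper, hword⟩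
  have hred : Reduced (seqWord x (v.length + v.length)) := by
    rw [seqWord_add, Periodic.shift_eq hper, hword]; exact hv
  have hlt := Nat.mod_lt i hpos
  have h := reduced_seqWord_iff.1 hred (i % v.length) (by omega)
  have e1 : x (i % v.length) = x i := hper.map_mod_nat i
  have e2 : x (i % v.length + 1) = x (i + 1) := by simp [hx, Nat.add_mod]
  rwa [e1, e2] at h

lemma seqWord_rotate {x : ℕ → ι} {n : ℕ} (h : Function.Periodic x n) (j : ℕ) :
    (seqWord x n).rotate j = seqWord (fun i => x (i + j)) n := by
  refine List.ext_getElem (by simp) fun i h1 h2 => ?_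
  rw [List.getElem_rotate, getElem_seqWord, getElem_seqWord, length_seqWord]
  exact h.map_mod_nat _

lemma eq_of_seqWord_eq {x y : ℕ → ι} {n : ℕ} (hn : 0 < n) (hx : Function.Periodic x n)
    (hy : Function.Periodic y n) (h : seqWord x n = seqWord y n) : x = y := by
  funext i
  rw [← hx.map_mod_nat i, ← hy.map_mod_nat i]
  have hlt := Nat.mod_lt i hn
  rw [← getElem_seqWord x n (i % n) (by simpa using hlt),
    ← getElem_seqWord y n (i % n) (by simpa using hlt)]
  simp only [h]

end Sequences

/-- The shift of a sequence by two letters. Its periodic points among the admissible sequences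
encode the closed geodesics. -/
def shiftTwo (x : ℕ → Fin 3) : ℕ → Fin 3 := fun i => x (i + 2)

lemma shiftTwo_iterate (x : ℕ → Fin 3) (j : ℕ) : shiftTwo^[j] x = fun i => x (i + 2 * j) := by
  induction j generalizing x with
  | zero => rfl
  | succ j ih =>
    rw [Function.iterate_succ_apply, ih]
    funext i
    simp only [shiftTwo]
    congr 1

lemma isPeriodicPt_shiftTwo {x : ℕ → Fin 3} {m : ℕ} :
    Function.IsPeriodicPt shiftTwo m x ↔ Function.Periodic x (2 * m) := by
  rw [Function.IsPeriodicPt, Function.IsFixedPt, shiftTwo_iterate, funext_iff]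
  rfl

lemma Admissible.iterate {x : ℕ → Fin 3} (hx : Admissible x) (j : ℕ) :
    Admissible (shiftTwo^[j] x) := by
  intro i
  rw [shiftTwo_iterate]
  have := hx (i + 2 * j)
  rwa [add_right_comm] at this

/-! ### The reflection group -/

lemma refl_mul_self (b : ℝ) (i : Fin 3) : refl b i * refl b i = 1 :=
  Units.ext (reflMatrix_mul_self _ _ (sin_theta_ne_zero b))

lemma det_refl (b : ℝ) (i : Fin 3) : (refl b i).val.det = -1 := by
  have hs := sin_theta_ne_zero b
  simp only [refl, reflMatrix, Matrix.det_fin_two_of]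
  have h1 := Real.sin_sq_add_cos_sq (2 * Real.pi * ((i : ℝ) + 1) / 3)
  have h2 := Real.sin_sq_add_cos_sq (theta b)
  field_simp
  linarith

lemma det_wordProd (b : ℝ) (w : List (Fin 3)) :
    (wordProd (refl b) w).val.det = (-1) ^ w.length := by
  induction w with
  | nil => simp
  | cons a w ih =>
    rw [wordProd_cons, Units.val_mul, det_mul, ih, det_refl, List.length_cons, pow_succ]
    ring

lemma one_le_of_exp_neg_le {b : ℝ} (ha : Real.exp (-b) ≤ 1 / 100) : 1 ≤ b := by
  by_contra h
  have h1 : Real.exp (-1) ≤ Real.exp (-b) := Real.exp_le_exp.2 (by linarith)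
  have h2 := Real.exp_one_lt_d9
  rw [Real.exp_neg, inv_eq_one_div] at h1
  have h3 : 1 / 3 ≤ 1 / Real.exp 1 := one_div_le_one_div_of_le (Real.exp_pos 1) (by linarith)
  linarith

/-- The reflections generate the free product of three groups of order two: the product of a
word of odd length has determinant `-1`, that of a cyclically reduced word of even length has an
eigenvalue of absolute value larger than one, and other words are conjugate to shorter ones. -/
lemma wordProd_refl_ne_one {b : ℝ} (ha : Real.exp (-b) ≤ 1 / 100) (w : List (Fin 3)) (hw : w ≠ [])
    (hred : Reduced w) : wordProd (refl b) w ≠ 1 := by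
  induction hn : w.length using Nat.strong_induction_on generalizing w with
  | _ n ih =>
    intro h1
    have hdet := det_wordProd b w
    rw [h1] at hdet
    have heven : Even w.length := by
      by_contra hodd
      rw [Nat.not_even_iff_odd] at hodd
      rw [hodd.neg_one_pow] at hdet
      simp at hdet
      norm_num at hdet
    by_cases hc : CycReduced w
    · obtain ⟨x, hx, hper, hxw⟩ := exists_seqWord_eq hc hw
      have hpos : 0 < w.length := List.length_pos_iff.2 hw
      obtain ⟨μ, -, ⟨v, hv, hμ⟩, hlog⟩ := exists_eigenvalue ha hpos.ne' hx hper
      rw [hxw, h1] at hμ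
      simp only [Units.val_one, Matrix.one_mulVec] at hμ
      have hμ1 : μ = 1 := by
        have : (μ - 1) • v = 0 := by rw [sub_smul, ← hμ, one_smul, sub_self]
        rcases smul_eq_zero.1 this with h | h
        · linarith
        · exact absurd h hv
      rw [hμ1, abs_one, Real.log_one] at hlog
      have hb := one_le_of_exp_neg_le ha
      have hl := (abs_le.1 hlog).1
      have hexp := Real.exp_pos (-b)
      have hn1 : (1 : ℝ) ≤ w.length := by exact_mod_cast hpos
      have hsq : 20 * Real.exp (-b) ^ 2 ≤ 1 / 2 := by nlinarith
      have ht : 0 ≤ (turns x w.length : ℝ) * Real.exp (-b) := by positivity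
      nlinarith
    · obtain ⟨a, v, rfl⟩ := exists_eq_cons_append_of_not_cycReduced hred heven hc
      have hv : v ≠ [] := by
        rintro rfl
        simp [Reduced] at hred
      refine ih v.length (by rw [← hn]; simp) v hv
        (List.IsChain.left_of_append (List.IsChain.tail hred)) rfl ?_
      rw [wordProd_cons, wordProd_append, wordProd_cons, wordProd_nil, mul_one] at h1
      have h2 : refl b a * (wordProd (refl b) v * refl b a) * refl b a = refl b a := by
        rw [h1, one_mul]
      rw [mul_assoc, mul_assoc, refl_mul_self, mul_one] at h2
      exact mul_eq_left.1 h2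

lemma mem_surfaceGroup_iff {b : ℝ} {g : GL (Fin 2) ℝ} :
    g ∈ surfaceGroup b ↔ ∃ w : List (Fin 3), Even w.length ∧ wordProd (refl b) w = g := by
  constructor
  · rintro ⟨hg, hdet⟩
    obtain ⟨w, rfl⟩ : ∃ w, wordProd (refl b) w = g := by
      clear hdet
      induction hg using Subgroup.closure_induction with
      | mem g hg =>
        obtain ⟨i, rfl⟩ := hg
        exact ⟨[i], by simp⟩
      | one => exact ⟨[], rfl⟩
      | mul g h _ _ hg hh =>
        obtain ⟨v, rfl⟩ := hg
        obtain ⟨w, rfl⟩ := hh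
        exact ⟨v ++ w, wordProd_append _ _ _⟩
      | inv g _ hg =>
        obtain ⟨w, rfl⟩ := hg
        exact ⟨w.reverse, wordProd_reverse (refl_mul_self b) w⟩
    refine ⟨w, ?_, rfl⟩
    have h1 : (wordProd (refl b) w).val.det = 1 := congrArg Units.val (MonoidHom.mem_ker.1 hdet)
    rw [det_wordProd] at h1
    by_contra hodd
    rw [Nat.not_even_iff_odd] at hodd
    rw [hodd.neg_one_pow] at h1
    norm_num at h1
  · rintro ⟨w, hw, rfl⟩
    refine ⟨?_, MonoidHom.mem_ker.2 (Units.ext ?_)⟩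
    · refine Subgroup.list_prod_mem _ fun g hg => ?_
      obtain ⟨i, -, rfl⟩ := List.mem_map.1 hg
      exact Subgroup.subset_closure ⟨i, rfl⟩
    · have := det_wordProd b w
      rw [hw.neg_one_pow] at this
      exact this

/-! ### Closed geodesics and periodic sequences -/

/-- The element of the surface group given by the first `2 m` letters of a sequence. -/
def evenProd (b : ℝ) (x : ℕ → Fin 3) (m : ℕ) : surfaceGroup b :=
  ⟨wordProd (refl b) (seqWord x (2 * m)), mem_surfaceGroup_iff.2 ⟨_, by simp, rfl⟩⟩

lemma evenProd_mul (b : ℝ) {x : ℕ → Fin 3} {m : ℕ} (h : Function.Periodic x (2 * m)) (k : ℕ) :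
    evenProd b x (k * m) = evenProd b x m ^ k := by
  induction k with
  | zero => ext1; simp [evenProd]
  | succ k ih =>
    rw [pow_succ, ← ih]
    refine Subtype.ext ?_
    have hk : Function.Periodic x (2 * (k * m)) := by
      have := h.nat_mul k
      rwa [Nat.cast_id, mul_left_comm] at this
    change wordProd _ _ = wordProd _ _ * wordProd _ _
    rw [show 2 * ((k + 1) * m) = 2 * (k * m) + 2 * m by ring, seqWord_add, Periodic.shift_eq hk,
      wordProd_append]

lemma evenProd_ne_one {b : ℝ} (ha : Real.exp (-b) ≤ 1 / 100) {x : ℕ → Fin 3} (hx : Admissible x)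
    {m : ℕ} (hm : m ≠ 0) : evenProd b x m ≠ 1 := by
  intro h
  refine wordProd_refl_ne_one ha (seqWord x (2 * m)) ?_ (reduced_seqWord_iff.2 fun i _ => hx i)
    (congrArg Subtype.val h)
  rw [← List.length_pos_iff, length_seqWord]
  omega

/-- Two conjugate products come from periodic sequences in the same orbit of `shiftTwo`. -/
lemma eq_iterate_of_isConj {b : ℝ} (ha : Real.exp (-b) ≤ 1 / 100) {x y : ℕ → Fin 3}
    (hx : Admissible x) (hy : Admissible y) {m m' : ℕ} (hm : m ≠ 0)
    (hxm : Function.Periodic x (2 * m)) (hym : Function.Periodic y (2 * m'))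
    (h : IsConj (evenProd b x m) (evenProd b y m')) : m = m' ∧ ∃ j, y = shiftTwo^[j] x := by
  obtain ⟨c, hc⟩ := isConj_iff.1 h
  obtain ⟨u, hu, huc⟩ := mem_surfaceGroup_iff.1 c.2
  obtain ⟨u', hured, hu'u, -, hueven⟩ := exists_reduced (refl_mul_self b) u
  obtain ⟨j, hj, hrot⟩ := exists_rotate_of_conj (refl_mul_self b) (wordProd_refl_ne_one ha) u' hured
    (cycReduced_seqWord hx hxm) (cycReduced_seqWord hy hym)
    (by rw [← List.length_pos_iff, length_seqWord]; omega) (by simp)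
    (by
      rw [hu'u, huc]
      exact congrArg Subtype.val hc)
  have hmm : m = m' := by
    have := congrArg List.length hrot
    simp at this
    exact this.symm
  subst hmm
  refine ⟨rfl, ?_⟩
  obtain ⟨i, rfl⟩ : Even j := hj.2 (hueven.2 hu)
  refine ⟨i, ?_⟩
  rw [seqWord_rotate hxm] at hrot
  have e : (fun k => x (k + (i + i))) = shiftTwo^[i] x := by
    rw [shiftTwo_iterate, two_mul]
  rw [e] at hrot
  refine eq_of_seqWord_eq (n := 2 * m) (by omega) hym (fun k => ?_) hrot
  rw [shiftTwo_iterate]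
  change x (k + 2 * m + 2 * i) = x (k + 2 * i)
  rw [add_right_comm]
  exact hxm _

lemma isConj_evenProd_shiftTwo (b : ℝ) {x : ℕ → Fin 3} {m : ℕ}
    (hxm : Function.Periodic x (2 * m)) : IsConj (evenProd b x m) (evenProd b (shiftTwo x) m) := by
  have hmem : wordProd (refl b) (seqWord x 2) ∈ surfaceGroup b :=
    mem_surfaceGroup_iff.2 ⟨_, by simp, rfl⟩
  refine isConj_iff.2 ⟨⟨_, hmem⟩⁻¹, Subtype.ext ?_⟩
  change (wordProd (refl b) (seqWord x 2))⁻¹ * wordProd (refl b) (seqWord x (2 * m)) *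
    ((wordProd (refl b) (seqWord x 2))⁻¹)⁻¹ = wordProd (refl b) (seqWord (shiftTwo x) (2 * m))
  rw [inv_inv, mul_assoc, inv_mul_eq_iff_eq_mul, ← wordProd_append]
  have h1 : seqWord x 2 ++ seqWord (shiftTwo x) (2 * m) = seqWord x (2 + 2 * m) :=
    (seqWord_add x 2 (2 * m)).symm
  have h2 : seqWord x (2 * m) ++ seqWord x 2 = seqWord x (2 * m + 2) := by
    rw [seqWord_add, Periodic.shift_eq hxm]
  rw [← wordProd_append, h1, h2, add_comm]

lemma isConj_evenProd_iterate (b : ℝ) {x : ℕ → Fin 3} {m : ℕ}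
    (hxm : Function.Periodic x (2 * m)) (j : ℕ) :
    IsConj (evenProd b x m) (evenProd b (shiftTwo^[j] x) m) := by
  induction j with
  | zero => exact IsConj.refl _
  | succ j ih =>
    rw [Function.iterate_succ_apply']
    refine ih.trans (isConj_evenProd_shiftTwo b ?_)
    rw [← isPeriodicPt_shiftTwo] at hxm ⊢
    exact hxm.apply_iterate j

/-- Every nontrivial element of the surface group is conjugate to the product of a periodic
sequence, whose period does not exceed the length of any word for the element. -/
lemma exists_isConj_evenProd {b : ℝ} (g : surfaceGroup b) (hg : g ≠ 1) (w : List (Fin 3))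
    (hw : wordProd (refl b) w = g) (heven : Even w.length) :
    ∃ (x : ℕ → Fin 3) (m : ℕ), m ≠ 0 ∧ Admissible x ∧ Function.Periodic x (2 * m) ∧
      2 * m ≤ w.length ∧ IsConj g (evenProd b x m) := by
  obtain ⟨v, u, hv, hve, hvl, hue, hvu⟩ := exists_cycReduced (refl_mul_self b) w heven
  have hmem : wordProd (refl b) u ∈ surfaceGroup b := mem_surfaceGroup_iff.2 ⟨u, hue, rfl⟩
  have hne : v ≠ [] := by
    rintro rfl
    rw [wordProd_nil, hw, eq_comm, conj_eq_one_iff] at hvu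
    exact hg (Subtype.ext hvu)
  obtain ⟨x, hx, hper, hxv⟩ := exists_seqWord_eq hv hne
  obtain ⟨m, hm⟩ := hve
  rw [← two_mul] at hm
  rw [hm] at hper hxv
  have hpos : 0 < v.length := List.length_pos_iff.2 hne
  refine ⟨x, m, by omega, hx, hper, hm ▸ hvl, isConj_iff.2 ⟨⟨_, hmem⟩, Subtype.ext ?_⟩⟩
  change wordProd (refl b) u * (g : GL (Fin 2) ℝ) * (wordProd (refl b) u)⁻¹ =
    wordProd (refl b) (seqWord x (2 * m))
  rw [hxv, hvu, hw]

/-- The admissible sequences that are periodic under `shiftTwo`. -/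
abbrev PeriodicSeq : Type := {x : ℕ → Fin 3 // Admissible x ∧ x ∈ Function.periodicPts shiftTwo}

/-- The least period of a sequence under `shiftTwo`. -/
def PeriodicSeq.period (x : PeriodicSeq) : ℕ := Function.minimalPeriod shiftTwo x.1

lemma PeriodicSeq.period_pos (x : PeriodicSeq) : 0 < x.period :=
  Function.minimalPeriod_pos_of_mem_periodicPts x.2.2

lemma PeriodicSeq.periodic (x : PeriodicSeq) : Function.Periodic x.1 (2 * x.period) :=
  isPeriodicPt_shiftTwo.1 (Function.isPeriodicPt_minimalPeriod _ _)

/-- The shift acts on periodic sequences. -/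
def PeriodicSeq.iterate (x : PeriodicSeq) (j : ℕ) : PeriodicSeq :=
  ⟨shiftTwo^[j] x.1, x.2.1.iterate j, by
    obtain ⟨n, hn, h⟩ := x.2.2
    exact ⟨n, hn, h.apply_iterate j⟩⟩

lemma PeriodicSeq.period_iterate (x : PeriodicSeq) (j : ℕ) : (x.iterate j).period = x.period :=
  Function.minimalPeriod_apply_iterate x.2.2 j

/-- The primitive closed geodesic that belongs to a periodic sequence: the class of the product over
one period, which is not a proper power since a root would give a smaller period. -/
def toGeodesic {b : ℝ} (ha : Real.exp (-b) ≤ 1 / 100) (x : PeriodicSeq) : PrimitiveGeodesic b :=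
  ⟨ConjClasses.mk (evenProd b x.1 x.period), evenProd b x.1 x.period, rfl,
    evenProd_ne_one ha x.2.1 x.period_pos.ne', fun h n hn hpow => by
    have h1 : h ≠ 1 := by
      rintro rfl
      rw [one_pow] at hpow
      exact evenProd_ne_one ha x.2.1 x.period_pos.ne' hpow.symm
    obtain ⟨w, hwe, hw⟩ := mem_surfaceGroup_iff.1 h.2
    obtain ⟨y, m, hm, hy, hym, -, hconj⟩ := exists_isConj_evenProd h h1 w hw hwe
    have hconj' := hconj.pow n
    rw [hpow, ← evenProd_mul b hym n] at hconj'
    have hym' : Function.Periodic y (2 * (n * m)) := by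
      have := hym.nat_mul n
      rwa [Nat.cast_id, mul_left_comm] at this
    obtain ⟨hp, j, hj⟩ := eq_iterate_of_isConj ha x.2.1 hy x.period_pos.ne' x.periodic hym' hconj'
    have hper : (x.iterate j).period ∣ m := by
      refine Function.IsPeriodicPt.minimalPeriod_dvd ?_
      have h2 := isPeriodicPt_shiftTwo.2 hym
      rw [hj] at h2
      exact h2
    rw [PeriodicSeq.period_iterate] at hper
    have hle := Nat.le_of_dvd (Nat.pos_of_ne_zero hm) hper
    nlinarith [Nat.pos_of_ne_zero hm]⟩

/-- Two sequences give the same closed geodesic exactly if they lie in one orbit of the shift. -/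
lemma toGeodesic_eq_iff {b : ℝ} (ha : Real.exp (-b) ≤ 1 / 100) {x y : PeriodicSeq} :
    toGeodesic ha x = toGeodesic ha y ↔ ∃ j, y = x.iterate j := by
  constructor
  · intro h
    have h1 : IsConj (evenProd b x.1 x.period) (evenProd b y.1 y.period) :=
      ConjClasses.mk_eq_mk_iff_isConj.1 (congrArg Subtype.val h)
    obtain ⟨-, j, hj⟩ :=
      eq_iterate_of_isConj ha x.2.1 y.2.1 x.period_pos.ne' x.periodic y.periodic h1
    exact ⟨j, Subtype.ext hj⟩
  · rintro ⟨j, rfl⟩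
    refine Subtype.ext (ConjClasses.mk_eq_mk_iff_isConj.2 ?_)
    rw [PeriodicSeq.period_iterate]
    exact isConj_evenProd_iterate b x.periodic j

lemma toGeodesic_surjective {b : ℝ} (ha : Real.exp (-b) ≤ 1 / 100) :
    Function.Surjective (toGeodesic (b := b) ha) := by
  rintro ⟨c, g, hgc, hg1, hprim⟩
  obtain ⟨w, hwe, hw⟩ := mem_surfaceGroup_iff.1 g.2
  obtain ⟨x, m, hm, hx, hxm, -, hconj⟩ := exists_isConj_evenProd g hg1 w hw hwe
  have hpt := isPeriodicPt_shiftTwo.2 hxm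
  set X : PeriodicSeq := ⟨x, hx, m, Nat.pos_of_ne_zero hm, hpt⟩ with hX
  refine ⟨X, Subtype.ext ?_⟩
  obtain ⟨k, hk⟩ : X.period ∣ m := hpt.minimalPeriod_dvd
  rw [mul_comm] at hk
  have hk1 : k = 1 := by
    by_contra hk1
    have hk0 : k ≠ 0 := by
      rintro rfl
      simp at hk
      exact hm hk
    obtain ⟨c, hc⟩ := isConj_iff.1 hconj.symm
    refine hprim (c * evenProd b x X.period * c⁻¹) k (by omega) ?_
    rw [conj_pow, ← evenProd_mul b X.periodic k, ← hk]
    exact hc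
  rw [hk1, one_mul] at hk
  change ConjClasses.mk (evenProd b x X.period) = c
  rw [← hk, ← hgc]
  exact ConjClasses.mk_eq_mk_iff_isConj.2 hconj.symm

lemma wordLength_toGeodesic {b : ℝ} (ha : Real.exp (-b) ≤ 1 / 100) (x : PeriodicSeq) :
    wordLength (toGeodesic ha x) = 2 * x.period := by
  refine IsLeast.csInf_eq ⟨⟨seqWord x.1 (2 * x.period), by simp, _, rfl, rfl⟩, ?_⟩
  rintro n ⟨w, rfl, g, hg, hw⟩
  have hconj : IsConj g (evenProd b x.1 x.period) := ConjClasses.mk_eq_mk_iff_isConj.1 hg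
  have heven : Even w.length := by
    have h1 : (wordProd (refl b) w).val.det = 1 := by
      have := congrArg Units.val (MonoidHom.mem_ker.1 g.2.2)
      rw [hw] at this
      exact this
    rw [det_wordProd] at h1
    by_contra hodd
    rw [Nat.not_even_iff_odd] at hodd
    rw [hodd.neg_one_pow] at h1
    norm_num at h1
  have hg1 : g ≠ 1 := by
    rintro rfl
    exact evenProd_ne_one ha x.2.1 x.period_pos.ne' (isConj_one_right.1 hconj)
  obtain ⟨y, m, hm, hy, hym, hle, hconj'⟩ := exists_isConj_evenProd g hg1 w hw.symm heven
  obtain ⟨hxm, -⟩ := eq_iterate_of_isConj ha x.2.1 hy x.period_pos.ne' x.periodic hym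
    (hconj.symm.trans hconj')
  rw [hxm]
  exact hle

/-- The lengths of the closed geodesics to second order. -/
lemma geodesicLength_toGeodesic {b : ℝ} (ha : Real.exp (-b) ≤ 1 / 100) (x : PeriodicSeq) :
    |geodesicLength (toGeodesic ha x) - 2 * x.period * b -
        turns x.1 (2 * x.period) * Real.exp (-b)| ≤
      2 * x.period * (20 * Real.exp (-b) ^ 2) ∧
    b ≤ geodesicLength (toGeodesic ha x) := by
  have hpos := x.period_pos
  obtain ⟨μ, hμ0, ⟨v, hv, hμ⟩, hlog⟩ := exists_eigenvalue ha (n := 2 * x.period) (by omega) x.2.1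
    x.periodic
  have hb := one_le_of_exp_neg_le ha
  have hexp := Real.exp_pos (-b)
  have hlow : b ≤ 2 * Real.log |μ| := by
    have hl := (abs_le.1 hlog).1
    have hn1 : (2 : ℝ) ≤ (2 * x.period : ℕ) := by
      have : 2 ≤ 2 * x.period := by omega
      exact_mod_cast this
    have hsq : 20 * Real.exp (-b) ^ 2 ≤ 1 / 2 := by nlinarith
    have ht : 0 ≤ (turns x.1 (2 * x.period) : ℝ) * Real.exp (-b) := by positivity
    nlinarith
  have hdet : (evenProd b x.1 x.period).1.val.det = 1 := by
    have := det_wordProd b (seqWord x.1 (2 * x.period))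
    rw [length_seqWord, (even_two_mul _).neg_one_pow] at this
    exact this
  have htr := cosh_two_mul_log_abs hdet hμ0 hv hμ
  have hlen : geodesicLength (toGeodesic ha x) = 2 * Real.log |μ| := by
    refine IsLeast.csInf_eq ⟨?_, ?_⟩
    · obtain ⟨z, hz⟩ := (isLeast_dist_smul _ hdet (by linarith) htr).1
      exact ⟨_, rfl, z, hz⟩
    · rintro d ⟨g, hg, z, rfl⟩
      obtain ⟨c, hc⟩ := isConj_iff.1 (ConjClasses.mk_eq_mk_iff_isConj.1 hg).symm
      have hg' : (g : GL (Fin 2) ℝ).val =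
          c.1.val * (evenProd b x.1 x.period).1.val * c.1.val⁻¹ := by
        rw [← hc, ← Matrix.coe_units_inv]; rfl
      have hcu : IsUnit c.1.val := c.1.isUnit
      have hgd : (g : GL (Fin 2) ℝ).val.det = 1 := by
        rw [hg', Matrix.det_conj hcu, hdet]
      have hgt : (g : GL (Fin 2) ℝ).val.trace = (evenProd b x.1 x.period).1.val.trace := by
        rw [hg', Matrix.trace_mul_cycle, ← Matrix.coe_units_inv, Units.inv_mul, one_mul]
      rw [← hgt] at htr
      exact (isLeast_dist_smul _ hgd (by linarith) htr).2 ⟨_, rfl⟩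
  rw [hlen]
  refine ⟨?_, hlow⟩
  push_cast at hlog
  exact hlog

/-! ### Traces as sums over periodic sequences -/

/-- The first letter of a state; the states are the ordered pairs of distinct letters. -/
def stateFst : Fin 6 → Fin 3 := ![0, 0, 1, 1, 2, 2]

/-- The second letter of a state. -/
def stateSnd : Fin 6 → Fin 3 := ![1, 2, 0, 2, 0, 1]

/-- The state with given letters, with the value `0` if the letters agree. -/
def stateMk (i j : Fin 3) : Fin 6 :=
  (![![0, 0, 1], ![2, 0, 3], ![4, 5, 0]] : Fin 3 → Fin 3 → Fin 6) i j

lemma stateFst_ne_stateSnd (p : Fin 6) : stateFst p ≠ stateSnd p := by revert p; decide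

lemma stateMk_stateFst_stateSnd (p : Fin 6) : stateMk (stateFst p) (stateSnd p) = p := by
  revert p; decide

lemma stateFst_stateMk {i j : Fin 3} (h : i ≠ j) : stateFst (stateMk i j) = i := by
  revert i j; decide

lemma stateSnd_stateMk {i j : Fin 3} (h : i ≠ j) : stateSnd (stateMk i j) = j := by
  revert i j; decide

/-- The entries of `matA` as weights of transitions; a turn has weight `y`. -/
lemma matA_apply (y : ℂ) (p q : Fin 6) : matA y p q =
    if stateSnd p = stateFst q then if stateFst p = stateSnd q then 1 else y else 0 := by
  fin_cases p <;> fin_cases q <;> simp [matA, stateFst, stateSnd]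

/-- Closed paths of states correspond to periodic admissible sequences. -/
def pathEquiv (n : ℕ) [NeZero n] :
    {f : Fin n → Fin 6 // ∀ l, stateSnd (f l) = stateFst (f (l + 1))} ≃
      {x : ℕ → Fin 3 // Admissible x ∧ Function.Periodic x n} where
  toFun f := ⟨fun i => stateFst (f.1 (Fin.ofNat n i)), fun i => by
    have h : Fin.ofNat n (i + 1) = Fin.ofNat n i + 1 := by
      ext; simp [Fin.val_add]
    simp only [h, ← f.2]
    exact stateFst_ne_stateSnd _, fun i => by
    have h : Fin.ofNat n (i + n) = Fin.ofNat n i := by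
      ext; simp
    simp only [h]⟩
  invFun x := ⟨fun l => stateMk (x.1 l) (x.1 (l + 1)), fun l => by
    rw [stateSnd_stateMk (x.2.1 _), stateFst_stateMk (x.2.1 _)]
    have h : ((l + 1 : Fin n) : ℕ) = (l + 1) % n := by simp [Fin.val_add]
    rw [h]
    exact (x.2.2.map_mod_nat _).symm⟩
  left_inv f := by
    refine Subtype.ext (funext fun l => ?_)
    have h : Fin.ofNat n (l + 1) = l + 1 := by ext; simp [Fin.val_add]
    have h0 : Fin.ofNat n l = l := by ext; simp
    simp only [h, h0, ← f.2]
    exact stateMk_stateFst_stateSnd _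
  right_inv x := by
    refine Subtype.ext (funext fun i => ?_)
    simp only [stateFst_stateMk (x.2.1 _)]
    exact x.2.2.map_mod_nat i

lemma prod_ite_eq_pow_turns (y : ℂ) (x : ℕ → Fin 3) (n : ℕ) :
    ∏ i ∈ Finset.range n, (if x i = x (i + 2) then 1 else y) = y ^ turns x n := by
  rw [turns, ← Finset.prod_const, Finset.prod_filter]
  refine Finset.prod_congr rfl fun i _ => ?_
  by_cases h : x i = x (i + 2) <;> simp [h]

lemma trace_matA_pow (y : ℂ) (n : ℕ) [NeZero n] :
    (matA y ^ n).trace = ∑ f : {f : Fin n → Fin 6 // ∀ l, stateSnd (f l) = stateFst (f (l + 1))},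
      y ^ turns (pathEquiv n f).1 n := by
  classical
  rw [trace_pow_eq_sum, ← Finset.sum_filter_of_ne
    (p := fun f : Fin n → Fin 6 => ∀ l, stateSnd (f l) = stateFst (f (l + 1))),
    Finset.sum_subtype (p := fun f : Fin n → Fin 6 => ∀ l, stateSnd (f l) = stateFst (f (l + 1)))
      _ (by simp)]
  · refine Finset.sum_congr rfl fun f _ => ?_
    rw [← prod_ite_eq_pow_turns, ← Fin.prod_univ_eq_prod_range (fun i =>
      if (pathEquiv n f).1 i = (pathEquiv n f).1 (i + 2) then (1 : ℂ) else y)]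
    refine Finset.prod_congr rfl fun l _ => ?_
    have h0 : Fin.ofNat n l = l := by ext; simp
    have h2 : Fin.ofNat n (l + 2) = l + 1 + 1 := by
      ext; simp [Fin.val_add, Nat.add_assoc]
    rw [matA_apply, if_pos (f.2 l), f.2 (l + 1)]
    simp only [pathEquiv, Equiv.coe_fn_mk, h0, h2]
  · intro f _ hf l
    by_contra hne
    refine hf (Finset.prod_eq_zero (Finset.mem_univ l) ?_)
    rw [matA_apply, if_neg hne]

/-! ### The Euler product of the determinant -/

lemma card_path_le (n : ℕ) [NeZero n] : Nat.card
    {f : Fin n → Fin 6 // ∀ l, stateSnd (f l) = stateFst (f (l + 1))} ≤ 6 ^ n := by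
  refine (Nat.card_le_card_of_injective _ Subtype.val_injective).trans ?_
  simp

/-- The periodic sequence of a closed path of states of even length. -/
def pathToSeq (m : ℕ) [NeZero m]
    (f : {f : Fin (2 * m) → Fin 6 // ∀ l, stateSnd (f l) = stateFst (f (l + 1))}) : PeriodicSeq :=
  ⟨(pathEquiv (2 * m) f).1, (pathEquiv (2 * m) f).2.1, m, Nat.pos_of_neZero m,
    isPeriodicPt_shiftTwo.2 (pathEquiv (2 * m) f).2.2⟩

lemma pathToSeq_injective (m : ℕ) [NeZero m] : Function.Injective (pathToSeq m) := by
  intro f g h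
  exact (pathEquiv (2 * m)).injective (Subtype.ext (congrArg (fun z : PeriodicSeq => z.1) h))

lemma range_pathToSeq (m : ℕ) [NeZero m] :
    Set.range (pathToSeq m) = {x | Function.IsPeriodicPt shiftTwo m x.1} := by
  ext x
  constructor
  · rintro ⟨f, rfl⟩
    exact isPeriodicPt_shiftTwo.2 (pathEquiv (2 * m) f).2.2
  · intro hx
    refine ⟨(pathEquiv (2 * m)).symm ⟨x.1, x.2.1, isPeriodicPt_shiftTwo.1 hx⟩, Subtype.ext ?_⟩
    change ((pathEquiv (2 * m)) ((pathEquiv (2 * m)).symm _)).1 = x.1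
    rw [Equiv.apply_symm_apply]

open scoped Classical in
/-- A sum over the sequences of period `m` is a sum over closed paths. -/
lemma hasSum_ite_isPeriodicPt {E : Type*} [NormedAddCommGroup E] (m : ℕ) [NeZero m]
    (F : (ℕ → Fin 3) → E) :
    HasSum (fun x : PeriodicSeq => if Function.IsPeriodicPt shiftTwo m x.1 then F x.1 else 0)
      (∑ f : {f : Fin (2 * m) → Fin 6 // ∀ l, stateSnd (f l) = stateFst (f (l + 1))},
        F (pathEquiv (2 * m) f).1) := by
  rw [← (pathToSeq_injective m).hasSum_iff]
  · convert hasSum_fintype _ using 1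
    refine Finset.sum_congr rfl fun f _ => ?_
    have : Function.IsPeriodicPt shiftTwo m (pathToSeq m f).1 :=
      isPeriodicPt_shiftTwo.2 (pathEquiv (2 * m) f).2.2
    rw [Function.comp_apply, if_pos this]
    rfl
  · intro x hx
    rw [range_pathToSeq] at hx
    exact if_neg hx

open scoped Classical in
/-- There are at most `36 ^ m` sequences of period `m`. -/
lemma summable_ite_isPeriodicPt {c : ℕ → ℝ} (hc0 : c 0 = 0) (hc : ∀ m, 0 ≤ c m)
    (hs : Summable fun m => c m * 36 ^ m) :
    Summable fun q : ℕ × PeriodicSeq =>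
      if Function.IsPeriodicPt shiftTwo q.1 q.2.1 then c q.1 else 0 := by
  have hrow (m : ℕ) : ∃ S, HasSum (fun x : PeriodicSeq =>
      if Function.IsPeriodicPt shiftTwo m x.1 then c m else 0) S ∧ S ≤ c m * 36 ^ m := by
    rcases Nat.eq_zero_or_pos m with rfl | hm
    · exact ⟨0, by simp [hc0], by simp [hc0]⟩
    · have : NeZero m := ⟨hm.ne'⟩
      refine ⟨_, hasSum_ite_isPeriodicPt m fun _ => c m, ?_⟩
      rw [Finset.sum_const, Finset.card_univ, nsmul_eq_mul, mul_comm]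
      refine mul_le_mul_of_nonneg_left ?_ (hc m)
      have h := card_path_le (2 * m)
      rw [Nat.card_eq_fintype_card, pow_mul] at h
      exact_mod_cast h
  refine (summable_prod_of_nonneg fun q => ?_).2 ⟨fun m => (hrow m).choose_spec.1.summable, ?_⟩
  · dsimp only
    split_ifs
    exacts [hc _, le_rfl]
  · refine hs.of_nonneg_of_le (fun m => tsum_nonneg fun x => ?_) fun m => ?_
    · split_ifs
      exacts [hc _, le_rfl]
    · rw [(hrow m).choose_spec.1.tsum_eq]
      exact (hrow m).choose_spec.2

/-- A periodic sequence that represents a given closed geodesic. -/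
def geodesicSeq {b : ℝ} (ha : Real.exp (-b) ≤ 1 / 100) (γ : PrimitiveGeodesic b) : PeriodicSeq :=
  (toGeodesic_surjective ha γ).choose

lemma toGeodesic_geodesicSeq {b : ℝ} (ha : Real.exp (-b) ≤ 1 / 100) (γ : PrimitiveGeodesic b) :
    toGeodesic ha (geodesicSeq ha γ) = γ := (toGeodesic_surjective ha γ).choose_spec

/-- Sums over closed geodesics with weights decaying fast in the word length converge, and are
bounded independently of the surface. -/
lemma exists_tsum_period_le {c : ℕ → ℝ} (hc0 : c 0 = 0) (hc : ∀ m, 0 ≤ c m)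
    (hs : Summable fun m => c m * 36 ^ m) :
    ∃ K : ℝ, 0 ≤ K ∧ ∀ (b : ℝ) (ha : Real.exp (-b) ≤ 1 / 100),
      Summable (fun γ : PrimitiveGeodesic b => c (geodesicSeq ha γ).period) ∧
        ∑' γ : PrimitiveGeodesic b, c (geodesicSeq ha γ).period ≤ K := by
  classical
  have hsum := summable_ite_isPeriodicPt hc0 hc hs
  have hnn (q : ℕ × PeriodicSeq) :
      0 ≤ if Function.IsPeriodicPt shiftTwo q.1 q.2.1 then c q.1 else 0 := by
    split_ifs
    exacts [hc _, le_rfl]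
  refine ⟨∑' q : ℕ × PeriodicSeq, if Function.IsPeriodicPt shiftTwo q.1 q.2.1 then c q.1 else 0,
    tsum_nonneg hnn, fun b ha => ?_⟩
  have hinj : Function.Injective fun γ : PrimitiveGeodesic b =>
      ((geodesicSeq ha γ).period, geodesicSeq ha γ) := by
    intro γ γ' h
    rw [← toGeodesic_geodesicSeq ha γ, ← toGeodesic_geodesicSeq ha γ']
    exact congrArg _ (Prod.ext_iff.1 h).2
  have heq (γ : PrimitiveGeodesic b) : ((fun q : ℕ × PeriodicSeq =>
      if Function.IsPeriodicPt shiftTwo q.1 q.2.1 then c q.1 else 0) ∘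
      fun γ : PrimitiveGeodesic b => ((geodesicSeq ha γ).period, geodesicSeq ha γ)) γ =
        c (geodesicSeq ha γ).period :=
    if_pos (Function.isPeriodicPt_minimalPeriod _ _)
  constructor
  · exact (hsum.comp_injective hinj).congr heq
  · rw [← tsum_congr heq]
    exact tsum_comp_le_tsum_of_inj hsum hnn hinj

lemma turns_mul {x : ℕ → Fin 3} {n : ℕ} (h : Function.Periodic x n) (k : ℕ) :
    turns x (k * n) = k * turns x n := by
  induction k with
  | zero => simp [turns]
  | succ k ih =>
    have hk : Function.Periodic x (k * n) := h.nat_mul k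
    rw [add_mul, add_mul, one_mul, one_mul, ← ih]
    simp only [turns, Finset.card_filter]
    rw [Finset.sum_range_add]
    congr 1
    refine Finset.sum_congr rfl fun i _ => ?_
    have e1 : x (k * n + i) = x i := by rw [add_comm]; exact hk i
    have e2 : x (k * n + i + 2) = x (i + 2) := by rw [add_assoc, add_comm]; exact hk (i + 2)
    rw [e1, e2]

lemma turns_shift {x : ℕ → Fin 3} {n : ℕ} (h : Function.Periodic x n) :
    turns (shift x) n = turns x n := by
  have h1 := turns_succ x n
  have h2 : turns x (n + 1) = turns x n + if x n ≠ x (n + 2) then 1 else 0 := by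
    simp only [turns, Finset.card_filter, Finset.sum_range_succ]
  have e0 : x n = x 0 := by simpa using h 0
  have e2 : x (n + 2) = x 2 := by rw [add_comm]; exact h 2
  rw [e0, e2] at h2
  omega

lemma turns_iterate (x : PeriodicSeq) (j : ℕ) :
    turns (x.iterate j).1 (2 * (x.iterate j).period) = turns x.1 (2 * x.period) := by
  rw [PeriodicSeq.period_iterate]
  induction j with
  | zero => rfl
  | succ j ih =>
    have h := (x.iterate j).periodic
    rw [PeriodicSeq.period_iterate] at h
    have h' : Function.Periodic (shift (x.iterate j).1) (2 * x.period) := fun i => by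
      have := h (i + 1)
      rw [add_right_comm] at this
      exact this
    rw [← ih, ← turns_shift h, ← turns_shift h']
    have : (x.iterate (j + 1)).1 = shift (shift (x.iterate j).1) := by
      change shiftTwo^[j + 1] x.1 = _
      rw [Function.iterate_succ_apply']
      rfl
    rw [this]

/-- The fibre of `toGeodesic` over a closed geodesic is one orbit of the shift. -/
lemma hasSum_fibre {b : ℝ} (ha : Real.exp (-b) ≤ 1 / 100) (γ : PrimitiveGeodesic b)
    (F : PeriodicSeq → ℂ) (hF : ∀ x j, F (x.iterate j) = F x) :
    HasSum (fun x : {x : PeriodicSeq // toGeodesic ha x = γ} => F x.1)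
      ((geodesicSeq ha γ).period * F (geodesicSeq ha γ)) := by
  set x := geodesicSeq ha γ with hx
  have hxγ : toGeodesic ha x = γ := toGeodesic_geodesicSeq ha γ
  have hmem (j : ℕ) : toGeodesic ha (x.iterate j) = γ :=
    ((toGeodesic_eq_iff ha).2 ⟨j, rfl⟩).symm.trans hxγ
  set φ : Fin x.period → {x : PeriodicSeq // toGeodesic ha x = γ} :=
    fun j => ⟨x.iterate j, hmem j⟩ with hφ
  have hbij : Function.Bijective φ := by
    constructor
    · intro i j hij
      have h1 : shiftTwo^[(i : ℕ)] x.1 = shiftTwo^[(j : ℕ)] x.1 :=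
        congrArg (fun z => z.1.1) hij
      exact Fin.ext ((Function.iterate_eq_iterate_iff_of_lt_minimalPeriod i.2 j.2).1 h1)
    · rintro ⟨y, hy⟩
      obtain ⟨j, rfl⟩ := (toGeodesic_eq_iff ha).1 (hxγ.trans hy.symm)
      refine ⟨⟨j % x.period, Nat.mod_lt _ x.period_pos⟩, Subtype.ext (Subtype.ext ?_)⟩
      exact Function.iterate_mod_minimalPeriod_eq
  rw [← (Equiv.ofBijective φ hbij).hasSum_iff]
  have h := hasSum_fintype ((fun z : {x : PeriodicSeq // toGeodesic ha x = γ} => F z.1) ∘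
    Equiv.ofBijective φ hbij)
  have hval (j : Fin x.period) : ((fun z : {x : PeriodicSeq // toGeodesic ha x = γ} => F z.1) ∘
      Equiv.ofBijective φ hbij) j = F x := hF x j
  rw [Finset.sum_congr rfl fun j _ => hval j, Finset.sum_const, Finset.card_univ, Fintype.card_fin,
    nsmul_eq_mul] at h
  exact h

lemma sum_norm_matA_le {y : ℂ} (hy : ‖y‖ ≤ 1) (i : Fin 6) : ∑ j, ‖matA y i j‖ ≤ 2 := by
  fin_cases i <;> simp [matA, Fin.sum_univ_succ] <;> linarith

lemma sum_norm_matB_le {y : ℂ} (hy : ‖y‖ ≤ 1) (i : Fin 6) : ∑ j, ‖matB y i j‖ ≤ 4 := by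
  calc ∑ j, ‖matB y i j‖ ≤ ∑ j, ∑ k, ‖matA y i k‖ * ‖matA y k j‖ := by
        refine Finset.sum_le_sum fun j _ => ?_
        rw [matB_eq, pow_two, Matrix.mul_apply]
        exact norm_sum_le_of_le _ fun k _ => (norm_mul _ _).le
    _ = ∑ k, ‖matA y i k‖ * ∑ j, ‖matA y k j‖ := by
        rw [Finset.sum_comm]
        exact Finset.sum_congr rfl fun k _ => (Finset.mul_sum _ _ _).symm
    _ ≤ ∑ k, ‖matA y i k‖ * 2 :=
        Finset.sum_le_sum fun k _ =>
          mul_le_mul_of_nonneg_left (sum_norm_matA_le hy k) (norm_nonneg _)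
    _ ≤ 4 := by
        rw [← Finset.sum_mul]
        linarith [sum_norm_matA_le hy i]

/-- The weight of a periodic sequence in the limit of large `b`. -/
def limitWeight (u y : ℂ) (x : PeriodicSeq) : ℂ := u ^ x.period * y ^ turns x.1 (2 * x.period)

lemma norm_limitWeight_le {u y : ℂ} (hy : ‖y‖ ≤ 1) (x : PeriodicSeq) :
    ‖limitWeight u y x‖ ≤ ‖u‖ ^ x.period := by
  rw [limitWeight, norm_mul, norm_pow, norm_pow]
  exact mul_le_of_le_one_right (by positivity) (pow_le_one₀ (norm_nonneg _) hy)

lemma norm_limitWeight_lt_one {u y : ℂ} (hu : ‖u‖ ≤ 1 / 100) (hy : ‖y‖ ≤ 1) (x : PeriodicSeq) :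
    ‖limitWeight u y x‖ < 1 :=
  (norm_limitWeight_le hy x).trans_lt
    (pow_lt_one₀ (norm_nonneg _) (by linarith) x.period_pos.ne')

open scoped Classical in
/-- The summands of `-log det (1 - u B)`, indexed by a period and a sequence with that period. -/
def logSummand (u y : ℂ) (q : ℕ × PeriodicSeq) : ℂ :=
  if Function.IsPeriodicPt shiftTwo q.1 q.2.1 then u ^ q.1 * y ^ turns q.2.1 (2 * q.1) / q.1 else 0

lemma summable_logSummand {u y : ℂ} (hu : ‖u‖ ≤ 1 / 100) (hy : ‖y‖ ≤ 1) :
    Summable (logSummand u y) := by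
  classical
  have hs : Summable fun m : ℕ => (if m = 0 then 0 else (1 / 100 : ℝ) ^ m) * 36 ^ m := by
    have h36 := summable_geometric_of_lt_one (r := (36 / 100 : ℝ)) (by norm_num) (by norm_num)
    refine h36.of_nonneg_of_le (fun m => by split_ifs <;> positivity) fun m => ?_
    split_ifs
    · rw [zero_mul]; positivity
    · rw [← mul_pow]; norm_num
  refine (summable_ite_isPeriodicPt (c := fun m => if m = 0 then 0 else (1 / 100 : ℝ) ^ m)
    (by simp) (fun m => by split_ifs <;> positivity) hs).of_norm_bounded fun q => ?_
  unfold logSummand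
  by_cases hq : Function.IsPeriodicPt shiftTwo q.1 q.2.1
  · simp only [hq, if_true]
    by_cases hm : q.1 = 0
    · simp [hm]
    · rw [if_neg hm, norm_div, norm_mul, norm_pow, norm_pow, Complex.norm_natCast]
      have h1 : (1 : ℝ) ≤ q.1 := by exact_mod_cast Nat.pos_of_ne_zero hm
      refine (div_le_self (by positivity) h1).trans ?_
      exact (mul_le_of_le_one_right (by positivity) (pow_le_one₀ (norm_nonneg _) hy)).trans
        (pow_le_pow_left₀ (norm_nonneg _) hu _)
  · simp [hq]

lemma hasSum_logSummand_row (u y : ℂ) (m : ℕ) :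
    HasSum (fun x => logSummand u y (m, x)) (u ^ m * (matB y ^ m).trace / m) := by
  classical
  rcases Nat.eq_zero_or_pos m with rfl | hm
  · simp [logSummand]
  · have : NeZero m := ⟨hm.ne'⟩
    have h := hasSum_ite_isPeriodicPt m fun x => u ^ m * y ^ turns x (2 * m) / (m : ℂ)
    have ht : (matB y ^ m).trace = (matA y ^ (2 * m)).trace := by rw [matB_eq, ← pow_mul]
    rw [ht, trace_matA_pow, Finset.mul_sum, Finset.sum_div]
    exact h

lemma hasSum_logSummand_column {u y : ℂ} (hu : ‖u‖ ≤ 1 / 100) (hy : ‖y‖ ≤ 1) (x : PeriodicSeq) :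
    HasSum (fun m => logSummand u y (m, x))
      (-Complex.log (1 - limitWeight u y x) / x.period) := by
  classical
  have hinj : Function.Injective fun k : ℕ => k * x.period :=
    fun k l h => Nat.eq_of_mul_eq_mul_right x.period_pos h
  rw [← hinj.hasSum_iff]
  · have h := (Complex.hasSum_taylorSeries_neg_log (norm_limitWeight_lt_one hu hy x)).div_const
      (x.period : ℂ)
    suffices hfun : ∀ k : ℕ, ((fun m => logSummand u y (m, x)) ∘ fun k => k * x.period) k =
        limitWeight u y x ^ k / k / x.period by
      rw [funext hfun]
      exact h
    intro k
    have hper : Function.IsPeriodicPt shiftTwo (k * x.period) x.1 :=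
      (Function.isPeriodicPt_minimalPeriod shiftTwo x.1).const_mul k
    have hturns : turns x.1 (2 * (k * x.period)) = k * turns x.1 (2 * x.period) := by
      rw [← turns_mul x.periodic, mul_left_comm]
    simp only [Function.comp_apply, logSummand, if_pos hper, hturns, limitWeight]
    rw [mul_pow, ← pow_mul, ← pow_mul, mul_comm k x.period, mul_comm k (turns _ _), div_div]
    push_cast
    rw [mul_comm (x.period : ℂ)]
  · intro m hm
    refine if_neg fun hper => hm ?_
    obtain ⟨k, hk⟩ := Function.IsPeriodicPt.minimalPeriod_dvd hper
    exact ⟨k, (mul_comm _ _).trans hk.symm⟩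

/-- The determinant is an Euler product over the closed geodesics: the double series of `logSummand`
is summed over the sequences of each period, which gives the traces of the powers of `matB y`, and
over the periods of each sequence, which gives logarithms of the Euler factors. -/
lemma hasProd_one_sub_limitWeight {b : ℝ} (ha : Real.exp (-b) ≤ 1 / 100) {u y : ℂ}
    (hu : ‖u‖ ≤ 1 / 100) (hy : ‖y‖ ≤ 1) :
    HasProd (fun γ : PrimitiveGeodesic b => 1 - limitWeight u y (geodesicSeq ha γ))
      (1 - u • matB y).det := by
  obtain ⟨S, hS⟩ := summable_logSummand hu hy
  have hrow := hS.prod_fiberwise (hasSum_logSummand_row u y)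
  have hcol := ((Equiv.prodComm _ _).hasSum_iff.2 hS).prod_fiberwise
    (hasSum_logSummand_column hu hy)
  have hdet : (1 - u • matB y).det = Complex.exp (-S) := by
    refine det_one_sub_smul_eq_exp _ _ (fun l hl => ?_) hrow
    have := norm_le_of_mem_roots_charpoly (matB y) (by norm_num) (sum_norm_matB_le hy) hl
    rw [norm_mul]
    nlinarith [norm_nonneg u, norm_nonneg l]
  set F : PeriodicSeq → ℂ := fun x => -Complex.log (1 - limitWeight u y x) / x.period with hF
  have hinv (x : PeriodicSeq) (j : ℕ) : F (x.iterate j) = F x := by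
    have h := turns_iterate x j
    rw [PeriodicSeq.period_iterate] at h
    simp only [hF, limitWeight, PeriodicSeq.period_iterate, h]
  have hgeo : HasSum (fun γ : PrimitiveGeodesic b =>
      ((geodesicSeq ha γ).period : ℂ) * F (geodesicSeq ha γ)) S :=
    HasSum.sigma ((Equiv.sigmaFiberEquiv (toGeodesic (b := b) ha)).hasSum_iff.2 hcol)
      fun γ => hasSum_fibre ha γ F hinv
  have hexp (γ : PrimitiveGeodesic b) :
      Complex.exp (-(((geodesicSeq ha γ).period : ℂ) * F (geodesicSeq ha γ))) =
        1 - limitWeight u y (geodesicSeq ha γ) := by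
    have hp : ((geodesicSeq ha γ).period : ℂ) ≠ 0 := by
      exact_mod_cast (geodesicSeq ha γ).period_pos.ne'
    have hne : 1 - limitWeight u y (geodesicSeq ha γ) ≠ 0 := by
      intro h0
      have := norm_limitWeight_lt_one hu hy (geodesicSeq ha γ)
      rw [← sub_eq_zero.1 h0] at this
      simp at this
    rw [hF, mul_div_cancel₀ _ hp, neg_neg, Complex.exp_log hne]
  have hprod := hgeo.neg.cexp
  rw [hdet]
  simpa only [Function.comp_def, hexp] using hprod

/-! ### Comparison of infinite products -/

lemma norm_prod_one_sub_sub_prod_le {ι : Type*} (s : Finset ι) (f g : ι → ℂ) :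
    ‖∏ i ∈ s, (1 - f i) - ∏ i ∈ s, (1 - g i)‖ ≤
      (∑ i ∈ s, ‖f i - g i‖) * Real.exp (∑ i ∈ s, (‖f i‖ + ‖g i‖)) := by
  classical
  induction s using Finset.induction_on with
  | empty => simp
  | insert i s hi ih =>
    simp only [Finset.prod_insert hi, Finset.sum_insert hi]
    have hg : ‖∏ j ∈ s, (1 - g j)‖ ≤ Real.exp (∑ j ∈ s, (‖f j‖ + ‖g j‖)) := by
      rw [norm_prod, Real.exp_sum]
      refine Finset.prod_le_prod (fun _ _ => norm_nonneg _) fun j _ => ?_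
      refine (norm_sub_le _ _).trans ?_
      rw [norm_one]
      linarith [Real.add_one_le_exp (‖f j‖ + ‖g j‖), norm_nonneg (f j)]
    have he : 1 + ‖f i‖ ≤ Real.exp (‖f i‖ + ‖g i‖) := by
      linarith [Real.add_one_le_exp (‖f i‖ + ‖g i‖), norm_nonneg (g i)]
    have he1 : 1 ≤ Real.exp (‖f i‖ + ‖g i‖) := Real.one_le_exp (by positivity)
    have hsplit : (1 - f i) * ∏ j ∈ s, (1 - f j) - (1 - g i) * ∏ j ∈ s, (1 - g j) =
        (1 - f i) * (∏ j ∈ s, (1 - f j) - ∏ j ∈ s, (1 - g j)) -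
          (f i - g i) * ∏ j ∈ s, (1 - g j) := by ring
    have hS : 0 ≤ ∑ j ∈ s, ‖f j - g j‖ := Finset.sum_nonneg fun _ _ => norm_nonneg _
    have hE := Real.exp_pos (∑ j ∈ s, (‖f j‖ + ‖g j‖))
    rw [hsplit, Real.exp_add]
    set E := Real.exp (∑ j ∈ s, (‖f j‖ + ‖g j‖))
    set e := Real.exp (‖f i‖ + ‖g i‖)
    have h1 : ‖1 - f i‖ ≤ e := (norm_sub_le _ _).trans (by rw [norm_one]; exact he)
    calc _ ≤ ‖1 - f i‖ * ‖∏ j ∈ s, (1 - f j) - ∏ j ∈ s, (1 - g j)‖ +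
          ‖f i - g i‖ * ‖∏ j ∈ s, (1 - g j)‖ := by
          refine (norm_sub_le _ _).trans ?_
          rw [norm_mul, norm_mul]
      _ ≤ e * ((∑ j ∈ s, ‖f j - g j‖) * E) + ‖f i - g i‖ * (e * E) := by
          refine add_le_add (mul_le_mul h1 ih (norm_nonneg _) (by positivity))
            (mul_le_mul_of_nonneg_left (hg.trans ?_) (norm_nonneg _))
          exact le_mul_of_one_le_left hE.le he1
      _ = (‖f i - g i‖ + ∑ j ∈ s, ‖f j - g j‖) * (e * E) := by ring

/-- Absolutely convergent products depend in a Lipschitz manner on their factors. -/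
lemma norm_sub_le_of_hasProd {ι : Type*} {f g : ι → ℂ} {A B : ℂ}
    (hA : HasProd (fun i => 1 - f i) A) (hB : HasProd (fun i => 1 - g i) B) {d m : ι → ℝ}
    (hd : ∀ i, ‖f i - g i‖ ≤ d i) (hm : ∀ i, ‖f i‖ + ‖g i‖ ≤ m i) (hds : Summable d)
    (hms : Summable m) : ‖A - B‖ ≤ (∑' i, d i) * Real.exp (∑' i, m i) := by
  have hd0 (i : ι) : 0 ≤ d i := (norm_nonneg _).trans (hd i)
  have hm0 (i : ι) : 0 ≤ m i := (add_nonneg (norm_nonneg _) (norm_nonneg _)).trans (hm i)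
  refine le_of_tendsto (hA.sub hB).norm (Eventually.of_forall fun s => ?_)
  refine (norm_prod_one_sub_sub_prod_le s f g).trans ?_
  refine mul_le_mul ?_ (Real.exp_le_exp.2 ?_) (Real.exp_pos _).le (tsum_nonneg hd0)
  · exact (Finset.sum_le_sum fun i _ => hd i).trans (hds.sum_le_tsum s fun i _ => hd0 i)
  · exact (Finset.sum_le_sum fun i _ => hm i).trans (hms.sum_le_tsum s fun i _ => hm0 i)

lemma norm_exp_neg_sub_exp_neg_le {v w : ℂ} (hv : 0 ≤ v.re) (hw : 0 ≤ w.re) :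
    ‖Complex.exp (-v) - Complex.exp (-w)‖ ≤ ‖v - w‖ := by
  have h := (convex_halfSpace_re_le 0).norm_image_sub_le_of_norm_hasDerivWithin_le
    (f := Complex.exp) (f' := Complex.exp) (C := 1) (x := -w) (y := -v)
    (fun z _ => (Complex.hasDerivAt_exp z).hasDerivWithinAt)
    (fun z hz => by rw [Complex.norm_exp]; exact Real.exp_le_one_iff.2 hz) (by simpa using hw)
    (by simpa using hv)
  rw [one_mul, neg_sub_neg, norm_sub_rev w v] at h
  exact h

/-! ### Comparison of the zeta function with the determinant -/

/-- The weight of a closed geodesic in the factor number `n` of the zeta product. -/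
def zetaWeight (b : ℝ) (s z : ℂ) (p : ℕ × PrimitiveGeodesic b) : ℂ :=
  z ^ wordLength p.2 * Complex.exp (-((s + p.1) * geodesicLength p.2))

/-- The limit of the weights for large `b`: only the factors with `n = 0` survive. -/
def zetaLimitWeight {b : ℝ} (ha : Real.exp (-b) ≤ 1 / 100) (u y : ℂ)
    (p : ℕ × PrimitiveGeodesic b) : ℂ :=
  if p.1 = 0 then limitWeight u y (geodesicSeq ha p.2) else 0

/-- The majorant `m / 100 ^ m` of the weights of the geodesics of word length `2 m` for
`‖z‖ ≤ 1 / 10`. Its series still converges after multiplication by `36 ^ m`, a bound for the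
number of these geodesics. -/
def majorant (m : ℕ) : ℝ := m * (1 / 100) ^ m

lemma majorant_nonneg (m : ℕ) : 0 ≤ majorant m := by unfold majorant; positivity

lemma pow_le_majorant {m : ℕ} (hm : 0 < m) : (1 / 100 : ℝ) ^ m ≤ majorant m := by
  have : (1 : ℝ) ≤ m := by exact_mod_cast hm
  exact le_mul_of_one_le_left (by positivity) this

lemma summable_majorant : Summable fun m => majorant m * 36 ^ m := by
  have h := summable_pow_mul_geometric_of_norm_lt_one 1 (r := (36 / 100 : ℝ)) (by norm_num)
  refine h.congr fun m => ?_
  rw [majorant, pow_one, mul_assoc, ← mul_pow]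
  norm_num

section Comparison

variable {b : ℝ} (ha : Real.exp (-b) ≤ 1 / 100)

lemma wordLength_eq (γ : PrimitiveGeodesic b) :
    wordLength γ = 2 * (geodesicSeq ha γ).period := by
  conv_lhs => rw [← toGeodesic_geodesicSeq ha γ]
  exact wordLength_toGeodesic ha _

lemma geodesicLength_bounds (γ : PrimitiveGeodesic b) :
    |geodesicLength γ - 2 * (geodesicSeq ha γ).period * b -
        turns (geodesicSeq ha γ).1 (2 * (geodesicSeq ha γ).period) * Real.exp (-b)| ≤
      2 * (geodesicSeq ha γ).period * (20 * Real.exp (-b) ^ 2) ∧ b ≤ geodesicLength γ := by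
  have h := geodesicLength_toGeodesic ha (geodesicSeq ha γ)
  rwa [toGeodesic_geodesicSeq] at h

lemma re_sPoint (b σ t : ℝ) : (sPoint b σ t).re = σ / b := by
  have e : sPoint b σ t = ((σ / b : ℝ) : ℂ) + ((t * Real.exp b : ℝ) : ℂ) * Complex.I := by
    rw [sPoint]
    push_cast
    ring
  rw [e]
  simp only [Complex.add_re, Complex.re_ofReal_mul, Complex.ofReal_re, Complex.I_re, mul_zero,
    add_zero]

lemma norm_yVal (t : ℝ) : ‖yVal t‖ = 1 := by
  rw [yVal, Complex.norm_exp]; simp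

lemma norm_xVal_le {σ : ℝ} (hσ : 0 ≤ σ) (b t : ℝ) : ‖xVal b σ t‖ ≤ 1 := by
  rw [xVal, Complex.norm_exp, Real.exp_le_one_iff]
  have h : (-2 * (σ : ℂ) - 2 * Complex.I * t * b * Real.exp b).re = -2 * σ := by
    have e : (-2 * (σ : ℂ) - 2 * Complex.I * t * b * Real.exp b) =
        ((-2 * σ : ℝ) : ℂ) + ((-2 * t * b * Real.exp b : ℝ) : ℂ) * Complex.I := by
      push_cast
      ring
    rw [e]
    simp only [Complex.add_re, Complex.re_ofReal_mul, Complex.ofReal_re, Complex.I_re, mul_zero,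
      add_zero]
  rw [h]
  linarith

/-- The first-order comparison of the exponential of the length of one geodesic. -/
lemma norm_exp_length_sub_le {σ : ℝ} (hσ : 0 ≤ σ) (hσ1 : σ ≤ 1) (t : ℝ)
    (γ : PrimitiveGeodesic b) :
    ‖Complex.exp (-(sPoint b σ t * geodesicLength γ)) -
        xVal b σ t ^ (geodesicSeq ha γ).period *
          yVal t ^ turns (geodesicSeq ha γ).1 (2 * (geodesicSeq ha γ).period)‖ ≤
      42 * (geodesicSeq ha γ).period * ((1 + |t|) * Real.exp (-b)) := by
  obtain ⟨hlen, hlen'⟩ := geodesicLength_bounds ha γ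
  have hb := one_le_of_exp_neg_le ha
  have hturns := turns_le (geodesicSeq ha γ).1 (2 * (geodesicSeq ha γ).period)
  have hp := (geodesicSeq ha γ).period_pos
  generalize (geodesicSeq ha γ).period = p at *
  generalize turns (geodesicSeq ha γ).1 (2 * p) = T at *
  generalize geodesicLength γ = ℓ at *
  have hee : Real.exp b * Real.exp (-b) = 1 := by rw [← Real.exp_add]; simp
  have heec : Complex.exp b * Complex.exp (-b) = 1 := by rw [← Complex.exp_add]; simp
  have hbC : (b : ℂ) ≠ 0 := by
    have : b ≠ 0 := by linarith
    exact_mod_cast this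
  set w : ℂ := p * (2 * σ + 2 * Complex.I * t * b * Real.exp b) + T * (Complex.I * t) with hw
  have hwe : xVal b σ t ^ p * yVal t ^ T = Complex.exp (-w) := by
    rw [xVal, yVal, ← Complex.exp_nat_mul, ← Complex.exp_nat_mul, ← Complex.exp_add, hw]
    congr 1
    ring
  -- The term `T exp (-b)` of the length, times `i t exp b`, is the exponent `i t T` of `y ^ T`.
  have hvw : sPoint b σ t * ℓ - w =
      sPoint b σ t * ((ℓ - 2 * p * b - T * Real.exp (-b) : ℝ) : ℂ) +
        ((σ * T * Real.exp (-b) / b : ℝ) : ℂ) := by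
    rw [hw, sPoint]
    push_cast
    field_simp
    linear_combination (T * Complex.I * t * b) * heec
  have hs : ‖sPoint b σ t‖ ≤ (1 + |t|) * Real.exp b := by
    have h1 : ‖((σ : ℂ) / b)‖ ≤ 1 := by
      rw [norm_div, Complex.norm_real, Complex.norm_real, Real.norm_of_nonneg hσ,
        Real.norm_of_nonneg (by linarith), div_le_one (by linarith)]
      linarith
    have h2 : ‖Complex.I * t * Real.exp b‖ = |t| * Real.exp b := by
      rw [norm_mul, norm_mul, Complex.norm_I, one_mul, Complex.norm_real, Complex.norm_real,
        Real.norm_eq_abs, Real.norm_of_nonneg (Real.exp_pos b).le]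
    have h3 : 1 ≤ Real.exp b := Real.one_le_exp (by linarith)
    refine (norm_add_le _ _).trans ?_
    rw [h2]
    linarith
  have hTp : (T : ℝ) ≤ 2 * p := by exact_mod_cast hturns
  rw [hwe]
  refine (norm_exp_neg_sub_exp_neg_le ?_ ?_).trans ?_
  · rw [Complex.re_mul_ofReal, re_sPoint]
    exact mul_nonneg (div_nonneg hσ (by linarith)) (by linarith)
  · have e : w = ((2 * p * σ : ℝ) : ℂ) + ((2 * p * t * b * Real.exp b + T * t : ℝ) : ℂ) *
        Complex.I := by
      rw [hw]
      push_cast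
      ring
    rw [e]
    simp only [Complex.add_re, Complex.re_ofReal_mul, Complex.ofReal_re, Complex.I_re, mul_zero,
      add_zero]
    positivity
  · rw [hvw]
    have hpos := Real.exp_pos (-b)
    have h1 : ‖sPoint b σ t * ((ℓ - 2 * p * b - T * Real.exp (-b) : ℝ) : ℂ)‖ ≤
        40 * p * ((1 + |t|) * Real.exp (-b)) := by
      rw [norm_mul, Complex.norm_real, Real.norm_eq_abs]
      refine (mul_le_mul hs hlen (abs_nonneg _) (by positivity)).trans (le_of_eq ?_)
      linear_combination (40 * p * (1 + |t|) * Real.exp (-b)) * hee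
    have h2 : ‖((σ * T * Real.exp (-b) / b : ℝ) : ℂ)‖ ≤ 2 * p * ((1 + |t|) * Real.exp (-b)) := by
      rw [Complex.norm_real, Real.norm_of_nonneg (by positivity)]
      refine (div_le_self (by positivity) hb).trans ?_
      have h3 : σ * T ≤ 2 * p * (1 + |t|) :=
        (mul_le_of_le_one_left (by positivity) hσ1).trans
          (hTp.trans (le_mul_of_one_le_right (by positivity) (by linarith [abs_nonneg t])))
      nlinarith
    refine (norm_add_le _ _).trans ?_
    linarith

lemma norm_sq_mul_xVal_le {σ t : ℝ} (hσ : 0 ≤ σ) {z : ℂ} (hz : ‖z‖ ≤ 1 / 10) (b : ℝ) :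
    ‖z ^ 2 * xVal b σ t‖ ≤ 1 / 100 := by
  rw [norm_mul, norm_pow]
  have h1 : ‖z‖ ^ 2 ≤ (1 / 10) ^ 2 := pow_le_pow_left₀ (norm_nonneg _) hz 2
  have h2 := norm_xVal_le hσ b t
  nlinarith [norm_nonneg (xVal b σ t)]

lemma norm_pow_wordLength_le {z : ℂ} (hz : ‖z‖ ≤ 1 / 10) (γ : PrimitiveGeodesic b) :
    ‖z ^ wordLength γ‖ ≤ (1 / 100) ^ (geodesicSeq ha γ).period := by
  rw [wordLength_eq ha, norm_pow, pow_mul]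
  refine pow_le_pow_left₀ (by positivity) ?_ _
  calc ‖z‖ ^ 2 ≤ (1 / 10) ^ 2 := pow_le_pow_left₀ (norm_nonneg _) hz 2
    _ = 1 / 100 := by norm_num

/-- The factor number `n` is damped by `e ^ (- n b)`, as no geodesic is shorter than `b`. -/
lemma norm_zetaWeight_le {σ : ℝ} (hσ : 0 ≤ σ) (t : ℝ) {z : ℂ} (hz : ‖z‖ ≤ 1 / 10)
    (p : ℕ × PrimitiveGeodesic b) :
    ‖zetaWeight b (sPoint b σ t) z p‖ ≤
      majorant (geodesicSeq ha p.2).period * Real.exp (-b) ^ p.1 := by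
  obtain ⟨n, γ⟩ := p
  have hb := one_le_of_exp_neg_le ha
  have hℓ := (geodesicLength_bounds ha γ).2
  have hp := (geodesicSeq ha γ).period_pos
  rw [zetaWeight, norm_mul]
  refine mul_le_mul ((norm_pow_wordLength_le ha hz γ).trans (pow_le_majorant hp)) ?_
    (norm_nonneg _) (majorant_nonneg _)
  rw [Complex.norm_exp, ← Real.exp_nat_mul, Real.exp_le_exp, Complex.neg_re,
    Complex.re_mul_ofReal, Complex.add_re, re_sPoint, Complex.natCast_re]
  have h1 : (n : ℝ) * b ≤ n * geodesicLength γ := mul_le_mul_of_nonneg_left hℓ (Nat.cast_nonneg n)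
  have h2 : 0 ≤ σ / b * geodesicLength γ :=
    mul_nonneg (div_nonneg hσ (by linarith)) (by linarith)
  dsimp only
  linarith

lemma norm_zetaLimitWeight_le {u y : ℂ} (hu : ‖u‖ ≤ 1 / 100) (hy : ‖y‖ ≤ 1)
    (p : ℕ × PrimitiveGeodesic b) :
    ‖zetaLimitWeight ha u y p‖ ≤ majorant (geodesicSeq ha p.2).period * (1 / 2) ^ p.1 := by
  obtain ⟨n, γ⟩ := p
  have hp := (geodesicSeq ha γ).period_pos
  rw [zetaLimitWeight]
  split_ifs with h
  · dsimp only at h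
    subst h
    rw [pow_zero, mul_one]
    exact (norm_limitWeight_le hy _).trans
      ((pow_le_pow_left₀ (norm_nonneg _) hu _).trans (pow_le_majorant hp))
  · rw [norm_zero]
    exact mul_nonneg (majorant_nonneg _) (by positivity)

/-- For `n = 0` this is the comparison of lengths; for `n ≥ 1` the limit weight is zero and the
damping provides the factor `exp (-b)`. -/
lemma norm_zetaWeight_sub_le {σ : ℝ} (hσ : 0 ≤ σ) (hσ1 : σ ≤ 1) (t : ℝ) {z : ℂ}
    (hz : ‖z‖ ≤ 1 / 10) (p : ℕ × PrimitiveGeodesic b) :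
    ‖zetaWeight b (sPoint b σ t) z p -
        zetaLimitWeight ha (z ^ 2 * xVal b σ t) (yVal t) p‖ ≤
      42 * ((1 + |t|) * Real.exp (-b)) *
        (majorant (geodesicSeq ha p.2).period * (1 / 2) ^ p.1) := by
  have hpos := Real.exp_pos (-b)
  have hn := norm_zetaWeight_le ha hσ t hz p
  obtain ⟨n, γ⟩ := p
  have hm := majorant_nonneg (geodesicSeq ha γ).period
  rcases n with _ | n
  · have h := norm_exp_length_sub_le ha hσ hσ1 t γ
    have e : zetaWeight b (sPoint b σ t) z (0, γ) -
        zetaLimitWeight ha (z ^ 2 * xVal b σ t) (yVal t) (0, γ) =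
        z ^ wordLength γ * (Complex.exp (-(sPoint b σ t * geodesicLength γ)) -
          xVal b σ t ^ (geodesicSeq ha γ).period *
          yVal t ^ turns (geodesicSeq ha γ).1 (2 * (geodesicSeq ha γ).period)) := by
      rw [zetaWeight, zetaLimitWeight, if_pos rfl, limitWeight, wordLength_eq ha, mul_pow,
        ← pow_mul, Nat.cast_zero, add_zero]
      ring
    rw [e, norm_mul, pow_zero, mul_one]
    refine (mul_le_mul (norm_pow_wordLength_le ha hz γ) h (norm_nonneg _)
      (by positivity)).trans (le_of_eq ?_)
    rw [majorant]
    ring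
  · rw [zetaLimitWeight, if_neg (Nat.succ_ne_zero n), sub_zero]
    refine hn.trans ?_
    have h1 : Real.exp (-b) ^ n ≤ (1 / 2) ^ n :=
      pow_le_pow_left₀ hpos.le (ha.trans (by norm_num)) n
    dsimp only
    rw [pow_succ, pow_succ]
    have h2 : Real.exp (-b) ^ n * Real.exp (-b) ≤ (1 / 2) ^ n * Real.exp (-b) :=
      mul_le_mul_of_nonneg_right h1 hpos.le
    have h3 : Real.exp (-b) ≤ (1 + |t|) * Real.exp (-b) :=
      le_mul_of_one_le_left hpos.le (by linarith [abs_nonneg t])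
    calc _ ≤ majorant (geodesicSeq ha γ).period * ((1 / 2) ^ n * ((1 + |t|) * Real.exp (-b))) :=
          mul_le_mul_of_nonneg_left
            (h2.trans (mul_le_mul_of_nonneg_left h3 (by positivity))) hm
      _ ≤ 21 * (majorant (geodesicSeq ha γ).period *
            ((1 / 2) ^ n * ((1 + |t|) * Real.exp (-b)))) :=
          le_mul_of_one_le_left (by positivity) (by norm_num)
      _ = _ := by ring

lemma hasSum_majorant_mul {K : ℝ}
    (hK : Summable (fun γ : PrimitiveGeodesic b => majorant (geodesicSeq ha γ).period) ∧
      ∑' γ : PrimitiveGeodesic b, majorant (geodesicSeq ha γ).period ≤ K) :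
    Summable (fun p : ℕ × PrimitiveGeodesic b =>
        majorant (geodesicSeq ha p.2).period * (1 / 2) ^ p.1) ∧
      ∑' p : ℕ × PrimitiveGeodesic b,
        majorant (geodesicSeq ha p.2).period * (1 / 2) ^ p.1 ≤ 2 * K := by
  have h2 := summable_geometric_two
  have hs : Summable (fun p : ℕ × PrimitiveGeodesic b =>
      (1 / 2 : ℝ) ^ p.1 * majorant (geodesicSeq ha p.2).period) :=
    h2.mul_of_nonneg hK.1 (fun _ => by positivity) fun _ => majorant_nonneg _
  simp only [mul_comm (majorant _)]
  refine ⟨hs, ?_⟩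
  rw [← h2.tsum_mul_tsum hK.1 hs, tsum_geometric_two]
  linarith [hK.2]

/-- The factors with `n ≠ 0` of the limit product are equal to one. -/
lemma hasProd_one_sub_zetaLimitWeight {u y : ℂ} (hu : ‖u‖ ≤ 1 / 100) (hy : ‖y‖ ≤ 1) :
    HasProd (fun p : ℕ × PrimitiveGeodesic b => 1 - zetaLimitWeight ha u y p)
      (1 - u • matB y).det := by
  have hinj : Function.Injective fun γ : PrimitiveGeodesic b => ((0 : ℕ), γ) :=
    fun γ γ' h => (Prod.ext_iff.1 h).2
  refine (hinj.hasProd_iff fun p hp => ?_).1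
    (hasProd_one_sub_limitWeight ha hu hy)
  have h0 : p.1 ≠ 0 := fun h => hp ⟨p.2, Prod.ext h.symm rfl⟩
  rw [zetaLimitWeight, if_neg h0, sub_zero]

end Comparison

/-! ### Taylor coefficients -/

lemma iteratedDeriv_eval_zero (q : ℂ[X]) (n : ℕ) :
    iteratedDeriv n (fun z => q.eval z) 0 = n.factorial * q.coeff n := by
  have h (q : ℂ[X]) : deriv^[n] (fun z => q.eval z) = fun z => (derivative^[n] q).eval z := by
    induction n generalizing q with
    | zero => rfl
    | succ n ih =>
      rw [Function.iterate_succ_apply, Function.iterate_succ_apply, ← ih]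
      congr 1
      funext z
      exact q.deriv
  rw [iteratedDeriv_eq_iterate, h]
  dsimp only
  rw [← coeff_zero_eq_eval_zero, coeff_iterate_derivative, zero_add,
    Nat.descFactorial_self, nsmul_eq_mul]

/-- Cauchy's estimate for the Taylor coefficients of a function close to a polynomial. -/
lemma norm_taylorCoeff_sub_coeff_le {f : ℂ → ℂ} {q : ℂ[X]} {r R ε : ℝ} (hr : 0 < r) (hrR : r < R)
    (hf : DifferentiableOn ℂ f (Metric.ball 0 R))
    (h : ∀ z : ℂ, ‖z‖ < R → ‖f z - q.eval z‖ ≤ ε) (n : ℕ) :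
    ‖iteratedDeriv n f 0 / (n.factorial : ℂ) - q.coeff n‖ ≤ ε / r ^ n := by
  have hfa : AnalyticAt ℂ f 0 := hf.analyticAt (Metric.ball_mem_nhds 0 (hr.trans hrR))
  have hq : Differentiable ℂ fun z => q.eval z := q.differentiable
  have hsub : iteratedDeriv n (f - fun z => q.eval z) 0 =
      n.factorial * (iteratedDeriv n f 0 / (n.factorial : ℂ) - q.coeff n) := by
    rw [iteratedDeriv_sub hfa.contDiffAt (hq.contDiff.contDiffAt), iteratedDeriv_eval_zero]
    have : (n.factorial : ℂ) ≠ 0 := by exact_mod_cast n.factorial_ne_zero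
    field_simp
  have hc := Complex.norm_iteratedDeriv_le_of_forall_mem_sphere_norm_le (C := ε) n hr
    ((hf.sub hq.differentiableOn).diffContOnCl_ball (Metric.closedBall_subset_ball hrR))
    (fun z hz => h z (by rw [mem_sphere_zero_iff_norm.1 hz]; exact hrR))
  rw [hsub, norm_mul, Complex.norm_natCast, mul_div_assoc] at hc
  exact le_of_mul_le_mul_left hc (by exact_mod_cast n.factorial_pos)

/-- The polynomial `det (1 - x z ^ 2 B(y))` in the variable `z`. -/
def detPoly (x y : ℂ) : ℂ[X] :=
  ∑ k : Fin 7, C (x ^ (k : ℕ) * aeval y (polyP k)) * X ^ (2 * (k : ℕ))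

lemma eval_detPoly (x y z : ℂ) : (detPoly x y).eval z = (1 - (z ^ 2 * x) • matB y).det := by
  rw [det_one_sub_smul_matB, detPoly, eval_finsetSum]
  refine Finset.sum_congr rfl fun k _ => ?_
  rw [eval_C_mul, eval_pow, eval_X, mul_pow, pow_mul]
  ring

lemma coeff_detPoly (x y : ℂ) (k : Fin 7) :
    (detPoly x y).coeff (2 * (k : ℕ)) = x ^ (k : ℕ) * aeval y (polyP k) := by
  rw [detPoly, finsetSum_coeff, Finset.sum_eq_single k]
  · rw [coeff_C_mul_X_pow, if_pos rfl]
  · intro j _ hj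
    rw [coeff_C_mul_X_pow, if_neg]
    intro h
    exact hj (Fin.ext (by omega))
  · simp

lemma natDegree_detPoly_le (x y : ℂ) : (detPoly x y).natDegree ≤ 12 :=
  natDegree_sum_le_of_forall_le _ _ fun k _ =>
    (natDegree_C_mul_X_pow_le _ _).trans (by omega)

lemma det_eq_one_add_sum_coeff (x y : ℂ) :
    (1 - x • matB y).det = 1 + ∑ n ∈ Finset.Icc 1 12, (detPoly x y).coeff n := by
  have h := eval_detPoly x y 1
  rw [one_pow, one_mul] at h
  have h0 := coeff_detPoly x y 0
  simp only [Fin.val_zero, mul_zero, pow_zero, one_mul] at h0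
  rw [← h, eval_eq_sum_range' (Nat.lt_succ_of_le (natDegree_detPoly_le x y)),
    Finset.range_eq_Ico, Finset.sum_eq_sum_Ico_succ_bot (by norm_num), h0]
  simp [polyP]
  rfl

/-! ### The estimate for large `b` -/

section Estimate

variable {b : ℝ} (ha : Real.exp (-b) ≤ 1 / 100)

lemma zetaFactor_eq (b : ℝ) (s z : ℂ) (p : ℕ × PrimitiveGeodesic b) :
    zetaFactor b s z p = 1 + -zetaWeight b s z p := sub_eq_add_neg _ _

include ha in
lemma norm_zetaWeight_le_half {σ : ℝ} (hσ : 0 ≤ σ) (t : ℝ) {z : ℂ} (hz : ‖z‖ ≤ 1 / 10)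
    (p : ℕ × PrimitiveGeodesic b) :
    ‖zetaWeight b (sPoint b σ t) z p‖ ≤
      majorant (geodesicSeq ha p.2).period * (1 / 2) ^ p.1 :=
  (norm_zetaWeight_le ha hσ t hz p).trans (mul_le_mul_of_nonneg_left
    (pow_le_pow_left₀ (Real.exp_pos _).le (ha.trans (by norm_num)) _) (majorant_nonneg _))

variable {K : ℝ} (hK : Summable (fun γ : PrimitiveGeodesic b =>
    majorant (geodesicSeq ha γ).period) ∧
  ∑' γ : PrimitiveGeodesic b, majorant (geodesicSeq ha γ).period ≤ K)

include hK

lemma multipliable_zetaFactor {σ : ℝ} (hσ : 0 ≤ σ) (t : ℝ) {z : ℂ} (hz : ‖z‖ ≤ 1 / 10) :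
    Multipliable (zetaFactor b (sPoint b σ t) z) := by
  simp only [funext (zetaFactor_eq b _ z)]
  refine multipliable_one_add_of_summable (Summable.of_nonneg_of_le (fun _ => norm_nonneg _)
    (fun p => ?_) (hasSum_majorant_mul ha hK).1)
  rw [norm_neg]
  exact norm_zetaWeight_le_half ha hσ t hz p

lemma differentiableOn_selbergZeta {σ : ℝ} (hσ : 0 ≤ σ) (t : ℝ) :
    DifferentiableOn ℂ (selbergZeta b (sPoint b σ t)) (Metric.ball 0 (1 / 10)) := by
  have hd (p : ℕ × PrimitiveGeodesic b) :
      Differentiable ℂ fun z => -zetaWeight b (sPoint b σ t) z p := by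
    unfold zetaWeight
    fun_prop
  have h := Summable.hasProdLocallyUniformlyOn_one_add Metric.isOpen_ball
    (hasSum_majorant_mul ha hK).1 (f := fun p z => -zetaWeight b (sPoint b σ t) z p)
    (Eventually.of_forall fun p z hz => by
      rw [norm_neg]
      exact norm_zetaWeight_le_half ha hσ t (mem_ball_zero_iff.1 hz).le p)
    (fun p => (hd p).continuous.continuousOn)
  refine (TendstoLocallyUniformlyOn.differentiableOn h (Eventually.of_forall fun s => ?_)
    Metric.isOpen_ball).congr fun z _ => tprod_congr fun p => zetaFactor_eq b _ z p
  exact (Differentiable.fun_finsetProd fun p _ => (hd p).const_add 1).differentiableOn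

lemma norm_selbergZeta_sub_det_le {σ : ℝ} (hσ : 0 ≤ σ) (hσ1 : σ ≤ 1) (t : ℝ) {z : ℂ}
    (hz : ‖z‖ ≤ 1 / 10) :
    ‖selbergZeta b (sPoint b σ t) z - (1 - (z ^ 2 * xVal b σ t) • matB (yVal t)).det‖ ≤
      84 * K * Real.exp (4 * K) * ((1 + |t|) * Real.exp (-b)) := by
  obtain ⟨hs, hsK⟩ := hasSum_majorant_mul ha hK
  have hy := (norm_yVal t).le
  have hu := norm_sq_mul_xVal_le (t := t) hσ hz b
  have h := norm_sub_le_of_hasProd (multipliable_zetaFactor ha hK hσ t hz).hasProd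
    (hasProd_one_sub_zetaLimitWeight ha hu hy) (norm_zetaWeight_sub_le ha hσ hσ1 t hz)
    (fun p => add_le_add (norm_zetaWeight_le_half ha hσ t hz p)
      (norm_zetaLimitWeight_le ha hu hy p)) (hs.mul_left _) (hs.add hs)
  rw [hs.tsum_add hs, tsum_mul_left] at h
  refine h.trans ?_
  have hpos : 0 ≤ 42 * ((1 + |t|) * Real.exp (-b)) := by positivity
  calc _ ≤ 42 * ((1 + |t|) * Real.exp (-b)) * (2 * K) * Real.exp (4 * K) := by
        refine mul_le_mul (mul_le_mul_of_nonneg_left hsK hpos)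
          (Real.exp_le_exp.2 (by linarith)) (Real.exp_pos _).le (mul_nonneg hpos ?_)
        refine le_trans (tsum_nonneg fun p => ?_) hsK
        exact mul_nonneg (majorant_nonneg _) (by positivity)
    _ = _ := by ring

lemma norm_zetaCoeff_sub_coeff_le (hK0 : 0 ≤ K) {σ : ℝ} (hσ : 0 ≤ σ) (hσ1 : σ ≤ 1) (t : ℝ) {n : ℕ}
    (hn : n ≤ 12) :
    ‖zetaCoeff b n (sPoint b σ t) - (detPoly (xVal b σ t) (yVal t)).coeff n‖ ≤
      20 ^ 12 * (84 * K * Real.exp (4 * K)) * ((1 + |t|) * Real.exp (-b)) := by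
  have h := norm_taylorCoeff_sub_coeff_le (r := 1 / 20) (q := detPoly (xVal b σ t) (yVal t))
    (by norm_num) (by norm_num) (differentiableOn_selbergZeta ha hK hσ t)
    (fun z hz => by
      rw [eval_detPoly]
      exact norm_selbergZeta_sub_det_le ha hK hσ hσ1 t hz.le) n
  refine h.trans ?_
  rw [div_pow, one_pow, div_div_eq_mul_div, div_one, mul_comm, mul_assoc (20 ^ 12)]
  exact mul_le_mul_of_nonneg_right (pow_le_pow_right₀ (by norm_num) hn) (by positivity)

end Estimate

/-- The comparison on the whole strip. The constant is nonnegative, so that it may be enlarged to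
obtain the uniform statement for bounded `t`. -/
lemma exists_comparison :
    ∃ C : ℝ, 0 ≤ C ∧ ∀ b : ℝ, Real.log 100 ≤ b → ∀ σ : ℝ, 0 ≤ σ → σ ≤ Real.log 2 → ∀ t : ℝ,
      (∀ᶠ z in 𝓝 (0 : ℂ), Multipliable (zetaFactor b (sPoint b σ t) z)) ∧
      AnalyticAt ℂ (fun z => selbergZeta b (sPoint b σ t) z) 0 ∧
      (∀ k : Fin 7, ‖zetaCoeff b (2 * (k : ℕ)) (sPoint b σ t) -
          xVal b σ t ^ (k : ℕ) * aeval (yVal t) (polyP k)‖ ≤ C * (1 + |t|) * Real.exp (-b)) ∧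
      ‖partialZeta b 12 (sPoint b σ t) - (1 - xVal b σ t • matB (yVal t)).det‖
        ≤ C * (1 + |t|) * Real.exp (-b) := by
  obtain ⟨K, hK0, hK⟩ := exists_tsum_period_le (c := majorant) (by simp [majorant])
    majorant_nonneg summable_majorant
  have hc : 0 ≤ 20 ^ 12 * (84 * K * Real.exp (4 * K)) := by positivity
  refine ⟨12 * (20 ^ 12 * (84 * K * Real.exp (4 * K))), by positivity,
    fun b hb σ hσ hσ2 t => ?_⟩
  have ha : Real.exp (-b) ≤ 1 / 100 := by
    rw [Real.exp_neg, one_div]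
    exact inv_anti₀ (by norm_num) ((Real.log_le_iff_le_exp (by norm_num)).1 hb)
  have hσ1 : σ ≤ 1 := hσ2.trans (by linarith [Real.log_le_sub_one_of_pos (x := 2) (by norm_num)])
  have hball : Metric.ball (0 : ℂ) (1 / 10) ∈ 𝓝 (0 : ℂ) := Metric.ball_mem_nhds 0 (by norm_num)
  have hcoeff (n : ℕ) (hn : n ≤ 12) := norm_zetaCoeff_sub_coeff_le ha (hK b ha) hK0 hσ hσ1 t hn
  have hte : 0 ≤ (1 + |t|) * Real.exp (-b) := by positivity
  refine ⟨?_, (differentiableOn_selbergZeta ha (hK b ha) hσ t).analyticAt hball, fun k => ?_, ?_⟩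
  · filter_upwards [hball] with z hz
    exact multipliable_zetaFactor ha (hK b ha) hσ t (mem_ball_zero_iff.1 hz).le
  · have h := hcoeff (2 * k) (by omega)
    rw [coeff_detPoly] at h
    rw [mul_assoc]
    exact h.trans (mul_le_mul_of_nonneg_right (by linarith) hte)
  · rw [partialZeta, det_eq_one_add_sum_coeff, add_sub_add_left_eq_sub, ← Finset.sum_sub_distrib]
    refine (norm_sum_le_of_le _ fun n hn => hcoeff n (Finset.mem_Icc.1 hn).2).trans (le_of_eq ?_)
    rw [Finset.sum_const, Nat.card_Icc, nsmul_eq_mul]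
    push_cast
    ring

end ThreeFunnel

end

theorem mainTheorem3 :
    -- the determinant through the explicit polynomials
    (∀ x y : ℂ, (1 - x • ThreeFunnel.matB y).det =
      ∑ k : Fin 7, x ^ (k : ℕ) * Polynomial.aeval y (ThreeFunnel.polyP k)) ∧
    -- the comparison on the whole strip, with the dependence on the height made explicit
    (∃ C b₀ : ℝ, 0 < b₀ ∧ ∀ b : ℝ, b₀ ≤ b → ∀ σ : ℝ, 0 ≤ σ → σ ≤ Real.log 2 → ∀ t : ℝ,
      (∀ᶠ z in 𝓝 (0 : ℂ), Multipliable
        (ThreeFunnel.zetaFactor b (ThreeFunnel.sPoint b σ t) z)) ∧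
      AnalyticAt ℂ (fun z => ThreeFunnel.selbergZeta b (ThreeFunnel.sPoint b σ t) z) 0 ∧
      (∀ k : Fin 7, ‖ThreeFunnel.zetaCoeff b (2 * (k : ℕ)) (ThreeFunnel.sPoint b σ t) -
          ThreeFunnel.xVal b σ t ^ (k : ℕ) *
            Polynomial.aeval (ThreeFunnel.yVal t) (ThreeFunnel.polyP k)‖
        ≤ C * (1 + |t|) * Real.exp (-b)) ∧
      ‖ThreeFunnel.partialZeta b 12 (ThreeFunnel.sPoint b σ t) -
          (1 - ThreeFunnel.xVal b σ t • ThreeFunnel.matB (ThreeFunnel.yVal t)).det‖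
        ≤ C * (1 + |t|) * Real.exp (-b)) ∧
    -- in particular, the uniform rate on every compact part of the strip
    (∀ S : ℝ, 0 < S → ∃ C b₀ : ℝ, 0 < b₀ ∧ ∀ b : ℝ, b₀ ≤ b →
      ∀ σ : ℝ, 0 ≤ σ → σ ≤ Real.log 2 → ∀ t : ℝ, |t| ≤ S →
      ‖ThreeFunnel.partialZeta b 12 (ThreeFunnel.sPoint b σ t) -
          (1 - ThreeFunnel.xVal b σ t • ThreeFunnel.matB (ThreeFunnel.yVal t)).det‖
        ≤ C * Real.exp (-b)) := by
  obtain ⟨C, hC, h⟩ := ThreeFunnel.exists_comparison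
  refine ⟨ThreeFunnel.det_one_sub_smul_matB, ⟨C, Real.log 100, Real.log_pos (by norm_num), h⟩,
    fun S hS => ⟨C * (1 + S), Real.log 100, Real.log_pos (by norm_num),
      fun b hb σ hσ hσ2 t ht => ?_⟩⟩
  refine (h b hb σ hσ hσ2 t).2.2.2.trans ?_
  gcongr
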